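/- \textbf{Setting.} A finite-state machine with $k$ states for samples in $[0,1]$ has a value (prediction) $S_i$ for each state and, for each state $i$, maximal down- and up-steps $m_{d,i},m_{u,i}\ge 0$ and thresholds $0=T_{i,-m_{d,i}-1}<T_{i,-m_{d,i}}<\dots<T_{i,m_{u,i}}=1$; on a sample $x\in[T_{i,j-1},T_{i,j})$ (closed at $1$ if $j=m_{u,i}$) it moves from state $i$ to state $i+j$. If $\hat x_t$ is the value of the state at time $t$, the regret of $x_1^n$ is $\frac1n\sum_t (x_t-\hat x_t)^2-\frac1n\sum_t (x_t-\bar x)^2$ with $\bar x=\frac1n\sum_t x_t$. The maximal regret (for a given initial state) is $\limsup_{n\to\infty}\sup_{x_1^n\in[0,1]^n}$ of the regret. The machine is a Degenerated Tracking Memory (DTM) machine if its states, in index order, have strictly increasing values and, calling the states with value $\le\frac12$ the lower half and those with value $\ge\frac12$ the upper half (a state with value exactly $\frac12$ belongs to both), the maximal down-step in the lower half and the maximal up-step in the upper half are at most one state, and a jump that leaves a half is possible only as a jump to the adjacent state (hence only between the states nearest to $\frac12$). \textbf{Algorithm} for a desired regret $R_d>0$. Number the states of the lower half downwards from $\frac12$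 as $S_1>S_2>\dots$. Start (odd number of states) with $S_1=\frac12$, or (even number of states, if this is $<\frac12$) with $S_1=\max\{1-\sqrt{R_d+\frac14},\,2+\sqrt{R_d}-2\sqrt{R_d+\sqrt{R_d}+\frac12}\}$, with $m_{u,1}=1$ and $T_{1,0}=S_1+\sqrt{R_d}$, $T_{1,1}=1$. As long as the last state placed has value $>\sqrt{R_d}$, place the next state $i$: let $S_i$ be the least value $<S_{i-1}$ for which some $m\in\{1,\dots,i-1\}$ has a valid up threshold set, and let $m_{u,i}$ be such an $m$ and $T_{i,0},\dots,T_{i,m}$ such a set. Validity of $T_{i,0}<\dots<T_{i,m}=1$ means $T_{i,0}>\max\{0,S_i-\sqrt{R_d}\}$ and $$C_{2,l}\le T_{i,0}\le S_i+\sqrt{R_d},\qquad C_{j+1,l}\le T_{i,j-1}\le C_{j,h}\ (2\le j\le m),\qquad T_{i,m}\le C_{m+1,h},$$ where $C_{j,l}=\max(a-b)$ and $C_{j,h}=\min(a+b)$ over the $2^{j-1}$ choices $x_t\in\{0,\,S_{i-j+t-1}-\sqrt{R_d}\}$, $2\le t\le j$, with $$a=S_i+\sum_{t=2}^j(S_i-x_t),\qquad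 b=j\sqrt{R_d-\tfrac1j\sum_{t=2}^j(S_{i-j+t-1}-S_i)(S_{i-j+t-1}+S_i-2x_t)},$$ all radicands for $2\le j\le m+1$ being required to be nonnegative. When the run stops, with $S_n\le\sqrt{R_d}$, give each state $i<n$ a down-step of one state for samples below $S_i-\sqrt{R_d}$ and state $n$ no down-step, and let the upper half be the mirror image of the lower half under $x\mapsto 1-x$ (the state $\frac12$ is not doubled); this gives $2n-1$ (odd) or $2n$ (even) states. If there is a single state, it has no jumps. The output is the machine with the fewest states among the odd and even runs. \textbf{Theorem.} Let $R_d>0$. (1) If some DTM machine, with some initial state, has maximal regret at most $R_d$, then the runs of the algorithm have bounded length, every run whose last state exceeds $\sqrt{R_d}$ can be continued (the required least value exists), and the algorithm has an output. (2) Every output of the algorithm is a DTM machine, it has maximal regret at most $R_d$ from every initial state, and it has the fewest states: every DTM machine with maximal regret at most $R_d$ from some initial state has at least as many states. -/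

import Mathlib

namespace DTM

noncomputable section

/-! ### Finite-state predictors on `[0,1]` and their regret -/

/-- A deterministic finite-state machine with `k` states for samples in `[0,1]`. State `i` predicts
`value i`, and it can be left by jumps of at most `down i` states down and `up i` states up.
The thresholds `thr i j`, `-down i - 1 ≤ j ≤ up i`, increase from `0` to `1`; a sample
`x ∈ [thr i (j-1), thr i j)` makes the machine jump `j` states (the topmost interval
`[thr i (up i - 1), 1]` contains the sample `1`). Values of `thr i` outside
`-down i - 1, …, up i` play no role. -/
structure FSM (k : ℕ) where
  value : Fin k → ℝ
  down : Fin k → ℕ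
  up : Fin k → ℕ
  thr : Fin k → ℤ → ℝ
  down_le : ∀ i : Fin k, down i ≤ (i : ℕ)
  up_lt : ∀ i : Fin k, (i : ℕ) + up i < k
  thr_bot : ∀ i, thr i (-(down i : ℤ) - 1) = 0
  thr_top : ∀ i, thr i (up i) = 1
  thr_strictMono : ∀ i, StrictMonoOn (thr i) (Set.Icc (-(down i : ℤ) - 1) (up i))

namespace FSM

variable {k : ℕ}

/-- The transition function `φ(i, x)`: one starts at `i - down i` and moves up by one state for
every interior threshold that is `≤ x`. That this is the transition function described in the
docstring of `FSM` is proved in `next_eq`. -/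
def next (M : FSM k) (i : Fin k) (x : ℝ) : Fin k :=
  ⟨(i : ℕ) - M.down i +
      ((Finset.Ico (-(M.down i : ℤ)) (M.up i)).filter (fun j => M.thr i j ≤ x)).card, by
    have h1 := Finset.card_filter_le (Finset.Ico (-(M.down i : ℤ)) (M.up i))
      (fun j => M.thr i j ≤ x)
    have h2 := M.down_le i
    have h3 := M.up_lt i
    rw [Int.card_Ico] at h1
    omega⟩

/-- If `thr i (j-1) ≤ x < thr i j` (or `j = up i` is the topmost jump), the machine jumps `j`
states. -/
theorem next_eq (M : FSM k) (i : Fin k) (x : ℝ) (j : ℤ) (h1 : -(M.down i : ℤ) ≤ j)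
    (h2 : j ≤ M.up i) (h3 : M.thr i (j - 1) ≤ x) (h4 : x < M.thr i j ∨ j = M.up i) :
    ((M.next i x : ℕ) : ℤ) = (i : ℕ) + j := by
  have hf : (Finset.Ico (-(M.down i : ℤ)) (M.up i)).filter (fun l => M.thr i l ≤ x)
      = Finset.Ico (-(M.down i : ℤ)) j := by
    ext l
    simp only [Finset.mem_filter, Finset.mem_Ico]
    constructor
    · rintro ⟨⟨ha, hb⟩, hc⟩
      refine ⟨ha, ?_⟩
      rcases h4 with h4 | h4
      · by_contra hlt
        have := (M.thr_strictMono i).monotoneOn (a := j) (b := l)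
          ⟨by omega, h2⟩ ⟨by omega, by omega⟩ (by omega)
        linarith
      · omega
    · rintro ⟨ha, hb⟩
      refine ⟨⟨ha, by omega⟩, ?_⟩
      have := (M.thr_strictMono i).monotoneOn (a := l) (b := j - 1)
        ⟨by omega, by omega⟩ ⟨by omega, by omega⟩ (by omega)
      linarith
  have hd := M.down_le i
  simp only [next, hf, Int.card_Ico]
  omega

/-- The state at each time, when the machine is started in `s₀` and fed with `x 0, x 1, …`. -/
def state (M : FSM k) (s₀ : Fin k) (x : ℕ → Set.Icc (0 : ℝ) 1) : ℕ → Fin k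
  | 0 => s₀
  | t + 1 => M.next (state M s₀ x t) (x t)

/-- The regret on the first `n` samples: the mean square error of the predictions minus that of
the best constant prediction, the empirical mean. -/
def regret (M : FSM k) (s₀ : Fin k) (x : ℕ → Set.Icc (0 : ℝ) 1) (n : ℕ) : ℝ :=
  (1 / (n : ℝ)) * ∑ t ∈ Finset.range n, ((x t : ℝ) - M.value (M.state s₀ x t)) ^ 2
    - (1 / (n : ℝ)) * ∑ t ∈ Finset.range n,
        ((x t : ℝ) - (1 / (n : ℝ)) * ∑ u ∈ Finset.range n, (x u : ℝ)) ^ 2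

/-- The maximal regret: the worst regret over all sequences of length `n`, as `n → ∞`. -/
def maxRegret (M : FSM k) (s₀ : Fin k) : ℝ :=
  Filter.limsup (fun n : ℕ => ⨆ x : ℕ → Set.Icc (0 : ℝ) 1, M.regret s₀ x n) Filter.atTop

/-- Degenerated Tracking Memory machines. The states are listed in ascending order; those with
value `≤ 1/2` form the lower half and those with value `≥ 1/2` the upper half (a state with value
exactly `1/2` is the common middle state of both halves). From the lower half the machine goes down
at most one state, from the upper half it goes up at most one state. A jump that leaves one of the
halves is a jump to the adjacent state, so that it joins the states nearest to `1/2`. -/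
structure IsDTM (M : FSM k) : Prop where
  strictMono : StrictMono M.value
  down_le_one : ∀ i, M.value i ≤ 1 / 2 → M.down i ≤ 1
  up_le_one : ∀ i, 1 / 2 ≤ M.value i → M.up i ≤ 1
  leave_lower : ∀ i l : Fin k, M.value i ≤ 1 / 2 → 1 / 2 < M.value l →
    (l : ℕ) ≤ (i : ℕ) + M.up i → (l : ℕ) = i + 1
  leave_upper : ∀ i l : Fin k, 1 / 2 ≤ M.value i → M.value l < 1 / 2 →
    (i : ℕ) ≤ (l : ℕ) + M.down i → (i : ℕ) = l + 1

end FSM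

/-! ### The algorithm

The states of the lower half are `S 1 > S 2 > …`, numbered from `1/2` downwards. -/

/-- A combination of down samples on the circle of `j` steps that starts at state `i`: the states
passed on the way down are `S (i-j+1), …, S (i-1)`, and at each of them the sample is either `0` or
`√R` below the state. -/
def downSample (R : ℝ) (S : ℕ → ℝ) (i j : ℕ) (c : Fin (j - 1) → Bool) (u : Fin (j - 1)) : ℝ :=
  if c u then 0 else S (i - j + 1 + u) - √R

/-- The quantity `a` for the candidate value `s` of state `i`. -/
def circleA (R : ℝ) (S : ℕ → ℝ) (i : ℕ) (s : ℝ) (j : ℕ) (c : Fin (j - 1) → Bool) : ℝ :=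
  s + ∑ u, (s - downSample R S i j c u)

/-- The radicand of `b`; if it is negative, no up sample gives regret at most `R`. -/
def radicand (R : ℝ) (S : ℕ → ℝ) (i : ℕ) (s : ℝ) (j : ℕ) (c : Fin (j - 1) → Bool) : ℝ :=
  R - (1 / (j : ℝ)) * ∑ u : Fin (j - 1), (S (i - j + 1 + u) - s) *
    (S (i - j + 1 + u) + s - 2 * downSample R S i j c u)

/-- The quantity `b`. -/
def circleB (R : ℝ) (S : ℕ → ℝ) (i : ℕ) (s : ℝ) (j : ℕ) (c : Fin (j - 1) → Bool) : ℝ :=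
  j * √(radicand R S i s j c)

/-- `C_{j,l}`, the maximum of `a - b` over all combinations. -/
def cLow (R : ℝ) (S : ℕ → ℝ) (i : ℕ) (s : ℝ) (j : ℕ) : ℝ :=
  ⨆ c : Fin (j - 1) → Bool, (circleA R S i s j c - circleB R S i s j c)

/-- `C_{j,h}`, the minimum of `a + b` over all combinations. -/
def cHigh (R : ℝ) (S : ℕ → ℝ) (i : ℕ) (s : ℝ) (j : ℕ) : ℝ :=
  ⨅ c : Fin (j - 1) → Bool, (circleA R S i s j c + circleB R S i s j c)

/-- `T 0, …, T m` are valid up thresholds for state `i` with value `s` and maximal up-step `m`,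
given the values `S 1, …, S (i-1)`. The down threshold of the state is `max 0 (s - √R)`. -/
structure ValidThresholds (R : ℝ) (S : ℕ → ℝ) (i : ℕ) (s : ℝ) (m : ℕ) (T : ℕ → ℝ) : Prop where
  strictMono : StrictMonoOn T (Set.Iic m)
  down_lt : max 0 (s - √R) < T 0
  top : T m = 1
  radicand_nonneg : ∀ j, 2 ≤ j → j ≤ m + 1 → ∀ c, 0 ≤ radicand R S i s j c
  low_zero : cLow R S i s 2 ≤ T 0
  zero_le : T 0 ≤ s + √R
  low_le : ∀ j, 2 ≤ j → j ≤ m → cLow R S i s (j + 1) ≤ T (j - 1)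
  le_high : ∀ j, 2 ≤ j → j ≤ m → T (j - 1) ≤ cHigh R S i s j
  top_le : T m ≤ cHigh R S i s (m + 1)

/-- The algorithm is run once for an odd and once for an even number of states. -/
inductive Kind
  | odd
  | even

/-- The starting state `S 1`. -/
def start (R : ℝ) : Kind → ℝ
  | .odd => 1 / 2
  | .even => max (1 - √(R + 1 / 4)) (2 + √R - 2 * √(R + √R + 1 / 2))

/-- The number of states of the machine with `n` states `S 1, …, S n` and their mirror images. -/
def numStates (n : ℕ) : Kind → ℕ
  | .odd => 2 * n - 1
  | .even => 2 * n

/-- What the algorithm computes: values, maximal up-steps and up thresholds of the states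
`1, 2, …` of the lower half. -/
structure Placement where
  S : ℕ → ℝ
  m : ℕ → ℕ
  T : ℕ → ℕ → ℝ

/-- State `i` is chosen by the algorithm: among all values below `S (i-1)` which admit valid
thresholds for some maximal up-step in `1, …, i-1`, its value is the least, and `m i`, `T i` is a
maximal up-step and a valid threshold set for it. -/
structure IsStep (R : ℝ) (P : Placement) (i : ℕ) : Prop where
  lt : P.S i < P.S (i - 1)
  one_le : 1 ≤ P.m i
  le : P.m i ≤ i - 1
  valid : ValidThresholds R P.S i (P.S i) (P.m i) (P.T i)
  least : ∀ (s : ℝ) (m : ℕ) (T : ℕ → ℝ), s < P.S (i - 1) → 1 ≤ m → m ≤ i - 1 →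
    ValidThresholds R P.S i s m T → P.S i ≤ s

/-- `P` records a run of the algorithm in which the states `1, …, i` have been placed. A new state
is placed as long as the last one exceeds `√R`. The run for an even number of states needs a
starting state below `1/2`. -/
structure IsRun (R : ℝ) (κ : Kind) (i : ℕ) (P : Placement) : Prop where
  one_le : 1 ≤ i
  start_eq : P.S 1 = start R κ
  start_lt : κ = Kind.even → P.S 1 < 1 / 2
  m_one : P.m 1 = 1
  T_one_zero : P.T 1 0 = P.S 1 + √R
  T_one_one : P.T 1 1 = 1
  step : ∀ l, 2 ≤ l → l ≤ i → √R < P.S (l - 1) ∧ IsStep R P l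

/-- The run has stopped after `n` states. -/
def IsCompleteRun (R : ℝ) (κ : Kind) (n : ℕ) (P : Placement) : Prop :=
  IsRun R κ n P ∧ P.S n ≤ √R

/-- `M` is the machine with lower half `P` (`n` states) and mirrored upper half. Position `q < n`
of the ascending list holds state `n - q` of the lower half; `q.rev` is the mirror position of `q`.
The outermost thresholds are `0` and `1` in every machine. In the machine with only one state no
jump is possible. -/
structure IsMachineOf (R : ℝ) (n : ℕ) (P : Placement) {k : ℕ} (M : FSM k) : Prop where
  value_lower : ∀ q : Fin k, (q : ℕ) < n → M.value q = P.S (n - q)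
  up_lower : ∀ q : Fin k, (q : ℕ) < n → M.up q = if k = 1 then 0 else P.m (n - q)
  down_lower : ∀ q : Fin k, (q : ℕ) < n → M.down q = if (q : ℕ) = 0 then 0 else 1
  thr_down_lower : ∀ q : Fin k, (q : ℕ) < n → M.thr q (-1) = max 0 (P.S (n - q) - √R)
  thr_up_lower : ∀ q : Fin k, (q : ℕ) < n → ∀ j : ℕ, j < M.up q → M.thr q j = P.T (n - q) j
  value_upper : ∀ q : Fin k, n ≤ (q : ℕ) → M.value q = 1 - M.value q.rev
  up_upper : ∀ q : Fin k, n ≤ (q : ℕ) → M.up q = M.down q.rev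
  down_upper : ∀ q : Fin k, n ≤ (q : ℕ) → M.down q = M.up q.rev
  thr_upper : ∀ q : Fin k, n ≤ (q : ℕ) → ∀ j : ℤ, -(M.down q : ℤ) - 1 ≤ j → j ≤ M.up q →
    M.thr q j = 1 - M.thr q.rev (-j - 1)

/-- `M` is an output of the algorithm for the desired regret `R`: it is built from a complete run,
and no complete run of either kind gives fewer states. -/
def IsOutput (R : ℝ) {k : ℕ} (M : FSM k) : Prop :=
  (∃ κ n P, IsCompleteRun R κ n P ∧ k = numStates n κ ∧ IsMachineOf R n P M) ∧
    ∀ κ n P, IsCompleteRun R κ n P → k ≤ numStates n κ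

end

end DTM

/-!
Write `r = √R`. For a fixed constant `c`, a step with prediction `v` and sample `x` costs
`excess R c v x = (x - v)² - (x - c)² - R`, and since the mean is the best constant, the maximal
regret is at most `R` exactly when, for every `c`, the total excess along a path stays sublinear in
its length. Every use of the regret goes through potentials on the states: a potential whose
increments dominate the excess gives the upper bound (`FSM.maxRegret_le_of_potential`), and
conversely a small maximal regret gives such potentials on the reachable states, up to an
arbitrarily small error per step (`FSM.exists_controlled`). No decomposition of paths into circles
is needed.

In the lower half a state `v > r` goes down by one state on the samples in `[0, v - r]`. As the
excess is affine in the sample, the worst such step costs `downExcess R c v`, the larger of the two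
endpoint values, which is strictly increasing in `v ≥ r` (`downExcess_lt`). The circle that jumps
from state `i`, with value `s`, up by `J` states on the sample `X` and walks back down is harmless
if `circleExcess R S i s J c X ≤ 0` for all `c ∈ [0,1]`. Maximizing over `c` by completing the
square turns this into the bounds `a ± b` of the algorithm, so that valid thresholds are those for
which all circles are harmless (`validThresholds_iff_feasible`).

The monotonicity of `downExcess` has the following consequences.
* Lowering the higher states preserves feasibility, so the greedy run stays below every other chain
  of states that starts at least as high (`IsRun.le_chain`).
* The least value required by the algorithm is attained: limits of feasible thresholds are weakly
  increasing, and coinciding thresholds can be separated, because a sample admissible for the jumps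
  by `J` and by `J + 2` states is strictly admissible for the jump by `J + 1`
  (`circleExcess_neg`, `exists_least_feasible`).

A run that has not stopped can be continued if `r > 1/6`: slightly below the last state another
state is feasible, with the thresholds of the last state shifted upwards
(`exists_feasible_below`). A machine with maximal regret at most `R` forces `r > 1/6`
(`IsChain.one_sixth_lt`), unless `r ≥ 1/2` and a single state suffices.

For optimality, let a machine with maximal regret at most `R` have `a` states below `1/2`, `b`
states above `1/2` and no state at `1/2`. Its lower half together with the next state is a chain
with at most `a + 1` states that starts above `1/2`, so the odd run places at most `a + 1` states,
and likewise at most `b + 1`. The circle through the two middle states shows that one of them is at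
least as close to `1/2` as the start of the even run (`FSM.Controlled.start_le`), so the even run
places at most `a` or at most `b` states. Either way one of the two runs gives at most `a + b`
states. A machine with a state at `1/2` is compared with the odd run alone
(`FSM.Controlled.run_bounds`).

The output itself is bounded by the potential that sums `downExcess` along the lower half, continued
by its mirror image (`IsMachineOf.maxRegret_le`).
-/

namespace DTM

open Filter Topology

/-! ### Excess loss of steps and circles -/

/-- The loss at a step with prediction `v` and sample `x`, in excess of `R` and of the loss of the
constant prediction `c`. It is affine in `x`. -/
def excess (R c v x : ℝ) : ℝ := (x - v) ^ 2 - (x - c) ^ 2 - R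

/-- The largest excess loss of a step down from a state with value `v ≥ √R`, whose down samples
fill `[0, v - √R]`. -/
noncomputable def downExcess (R c v : ℝ) : ℝ := max (excess R c v 0) (excess R c v (v - √R))

theorem excess_mirror (R c v x : ℝ) : excess R (1 - c) (1 - v) (1 - x) = excess R c v x := by
  unfold excess; ring

/-- Steps whose sample is within `√R` of the prediction have no positive excess loss. -/
theorem excess_nonpos {R c v x : ℝ} (hR : 0 ≤ R) (h1 : v - √R ≤ x) (h2 : x ≤ v + √R) :
    excess R c v x ≤ 0 := by
  have hs := Real.sq_sqrt hR
  have : (x - v) ^ 2 ≤ √R ^ 2 := by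
    apply sq_le_sq'
    · linarith
    · linarith
  unfold excess
  nlinarith [sq_nonneg (x - c)]

theorem excess_le_max {R c v x a b : ℝ} (h1 : a ≤ x) (h2 : x ≤ b) :
    excess R c v x ≤ max (excess R c v a) (excess R c v b) := by
  unfold excess
  rcases le_total c v with h | h
  · exact le_max_of_le_left (by nlinarith [mul_nonneg (sub_nonneg.2 h) (sub_nonneg.2 h1)])
  · exact le_max_of_le_right (by nlinarith [mul_nonneg (sub_nonneg.2 h) (sub_nonneg.2 h2)])

theorem excess_le_downExcess {R c v x : ℝ} (h1 : 0 ≤ x) (h2 : x ≤ v - √R) :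
    excess R c v x ≤ downExcess R c v := excess_le_max h1 h2

theorem downExcess_of_le {R c v : ℝ} (hR : 0 ≤ R) (hv : √R ≤ v) (hc : c ≤ v) :
    downExcess R c v = v ^ 2 - R - c ^ 2 := by
  have hs := Real.sq_sqrt hR
  unfold downExcess excess
  rw [max_eq_left]
  · ring
  · nlinarith [mul_nonneg (sub_nonneg.2 hv) (sub_nonneg.2 hc)]

theorem downExcess_of_ge {R c v : ℝ} (hR : 0 ≤ R) (hv : √R ≤ v) (hc : v ≤ c) :
    downExcess R c v = -(c - v + √R) ^ 2 := by
  have hs := Real.sq_sqrt hR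
  unfold downExcess excess
  rw [max_eq_right]
  · nlinarith
  · nlinarith [mul_nonneg (sub_nonneg.2 hv) (sub_nonneg.2 hc)]

/-- Lowering the higher states of a circle relaxes the constraint. -/
theorem downExcess_lt {R c v v' : ℝ} (hR : 0 < R) (h0 : 0 ≤ c) (hv : √R ≤ v) (h : v < v') :
    downExcess R c v < downExcess R c v' := by
  have hr := Real.sqrt_pos.2 hR
  have hs := Real.sq_sqrt hR.le
  rcases le_total c v with h1 | h1
  · rw [downExcess_of_le hR.le hv h1, downExcess_of_le hR.le (by linarith) (by linarith)]
    nlinarith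
  · rw [downExcess_of_ge hR.le hv h1]
    rcases le_total c v' with h2 | h2
    · rw [downExcess_of_le hR.le (by linarith) h2]
      rcases eq_or_lt_of_le h1 with h3 | h3
      · subst h3; nlinarith
      · nlinarith
    · rw [downExcess_of_ge hR.le (by linarith) h2]
      nlinarith

theorem downExcess_mono {R c v v' : ℝ} (hR : 0 < R) (h0 : 0 ≤ c) (hv : √R ≤ v) (h : v ≤ v') :
    downExcess R c v ≤ downExcess R c v' := by
  rcases eq_or_lt_of_le h with rfl | h
  · exact le_rfl
  · exact (downExcess_lt hR h0 hv h).le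

theorem continuous_downExcess (R v : ℝ) : Continuous fun c => downExcess R c v := by
  unfold downExcess excess; fun_prop

/-- The excess loss of the circle on which the machine jumps from state `i`, with value `s`, up to
state `i - J` on the sample `X` and comes back by the worst down samples of the `J` states
`i - J, …, i - 1`. -/
noncomputable def circleExcess (R : ℝ) (S : ℕ → ℝ) (i : ℕ) (s : ℝ) (J : ℕ) (c X : ℝ) : ℝ :=
  excess R c s X + ∑ t ∈ Finset.range J, downExcess R c (S (i - 1 - t))

theorem circleExcess_zero (R : ℝ) (S : ℕ → ℝ) (i : ℕ) (s : ℝ) (c X : ℝ) :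
    circleExcess R S i s 0 c X = excess R c s X := by simp [circleExcess]

theorem circleExcess_succ (R : ℝ) (S : ℕ → ℝ) (i : ℕ) (s : ℝ) (J : ℕ) (c X : ℝ) :
    circleExcess R S i s (J + 1) c X =
      circleExcess R S i s J c X + downExcess R c (S (i - 1 - J)) := by
  simp [circleExcess, Finset.sum_range_succ, add_assoc]

theorem continuous_circleExcess (R : ℝ) (S : ℕ → ℝ) (i : ℕ) (s : ℝ) (J : ℕ) (X : ℝ) :
    Continuous fun c => circleExcess R S i s J c X := by
  have := continuous_downExcess R
  unfold circleExcess excess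
  fun_prop

theorem circleExcess_nonpos_of_mem {R : ℝ} {S : ℕ → ℝ} {i : ℕ} {s : ℝ} {J : ℕ} {c a b X : ℝ}
    (ha : circleExcess R S i s J c a ≤ 0) (hb : circleExcess R S i s J c b ≤ 0)
    (h1 : a ≤ X) (h2 : X ≤ b) : circleExcess R S i s J c X ≤ 0 := by
  unfold circleExcess at *
  rcases le_max_iff.1 (excess_le_max (R := R) (c := c) (v := s) h1 h2) with h | h <;> linarith

/-- If a sample is admissible both for the jump by `J` and for the jump by `J + 2` states, then it
is strictly inside the admissible range of the jump by `J + 1` states: the two increments of the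
excess loss are increasing. -/
theorem circleExcess_neg {R : ℝ} (hR : 0 < R) {S : ℕ → ℝ} {i : ℕ} {s : ℝ} {J : ℕ} {c X : ℝ}
    (hc : 0 ≤ c) (h1 : circleExcess R S i s J c X ≤ 0)
    (h2 : circleExcess R S i s (J + 2) c X ≤ 0) (hS : √R ≤ S (i - 1 - J))
    (hlt : S (i - 1 - J) < S (i - 1 - (J + 1))) : circleExcess R S i s (J + 1) c X < 0 := by
  have := downExcess_lt hR hc hS hlt
  rw [circleExcess_succ, circleExcess_succ] at h2
  rw [circleExcess_succ]
  by_contra! hcon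
  linarith

/-- Thresholds under which every circle through state `i`, with value `s`, that stays in the lower
half has regret at most `R`. -/
structure Feasible (R : ℝ) (S : ℕ → ℝ) (i : ℕ) (s : ℝ) (m : ℕ) (T : ℕ → ℝ) : Prop where
  strictMono : StrictMonoOn T (Set.Iic m)
  down_lt : max 0 (s - √R) < T 0
  top : T m = 1
  zero_le : T 0 ≤ s + √R
  circle : ∀ J, J < m → ∀ c, 0 ≤ c → c ≤ 1 →
    circleExcess R S i s (J + 1) c (T J) ≤ 0 ∧ circleExcess R S i s (J + 1) c (T (J + 1)) ≤ 0

theorem Feasible.mem_Icc {R : ℝ} {S : ℕ → ℝ} {i : ℕ} {s : ℝ} {m : ℕ} {T : ℕ → ℝ}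
    (h : Feasible R S i s m T) {j : ℕ} (hj : j ≤ m) : 0 < T j ∧ T j ≤ 1 := by
  refine ⟨?_, ?_⟩
  · have h0 := (le_max_left _ _).trans_lt h.down_lt
    exact h0.trans_le (h.strictMono.monotoneOn (by simp) (by simpa using hj) (Nat.zero_le _))
  · rw [← h.top]
    exact h.strictMono.monotoneOn (by simpa using hj) (by simp) hj

/-- A value and thresholds stay feasible when the higher states are lowered. -/
theorem Feasible.of_le {R : ℝ} (hR : 0 < R) {S S' : ℕ → ℝ} {i : ℕ} {s : ℝ} {m : ℕ} {T : ℕ → ℝ}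
    (h : Feasible R S i s m T) (hm : m ≤ i - 1)
    (hS : ∀ l, 1 ≤ l → l < i → √R ≤ S' l ∧ S' l ≤ S l) : Feasible R S' i s m T := by
  refine ⟨h.strictMono, h.down_lt, h.top, h.zero_le, fun J hJ c h0 h1 => ?_⟩
  have key : ∑ t ∈ Finset.range (J + 1), downExcess R c (S' (i - 1 - t)) ≤
      ∑ t ∈ Finset.range (J + 1), downExcess R c (S (i - 1 - t)) := by
    refine Finset.sum_le_sum fun t ht => ?_
    have ht := Finset.mem_range.1 ht
    obtain ⟨ha, hb⟩ := hS (i - 1 - t) (by omega) (by omega)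
    exact downExcess_mono hR h0 ha hb
  have := h.circle J hJ c h0 h1
  unfold circleExcess at *
  exact ⟨by linarith, by linarith⟩

/-! ### Valid thresholds are feasible thresholds -/

theorem sum_downExcess_eq (R c : ℝ) (S : ℕ → ℝ) {i j : ℕ} (hj : j ≤ i) :
    ∑ t ∈ Finset.range (j - 1), downExcess R c (S (i - 1 - t)) =
      ∑ u : Fin (j - 1), downExcess R c (S (i - j + 1 + u)) := by
  rw [Fin.sum_univ_eq_sum_range (fun u => downExcess R c (S (i - j + 1 + u))),
    ← Finset.sum_range_reflect]
  refine Finset.sum_congr rfl fun u hu => ?_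
  have := Finset.mem_range.1 hu
  congr 2
  omega

/-- Completing the square in `c`: the best constant for a circle is the mean of its samples. -/
theorem circle_square (R : ℝ) (S : ℕ → ℝ) (i : ℕ) (s : ℝ) {j : ℕ} (hj : 1 ≤ j)
    (d : Fin (j - 1) → Bool) (c X : ℝ) :
    j * (excess R c s X +
        ∑ u : Fin (j - 1), excess R c (S (i - j + 1 + u)) (downSample R S i j d u)) =
      (X - circleA R S i s j d) ^ 2 - (j : ℝ) ^ 2 * radicand R S i s j d -
        (j * c - (X + ∑ u, downSample R S i j d u)) ^ 2 := by
  have hj0 : (j : ℝ) ≠ 0 := by positivity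
  have hcast : (((j - 1 : ℕ) : ℝ)) = j - 1 := by push_cast [hj]; ring
  have hconst : ∀ a : ℝ, ∑ _u : Fin (j - 1), a = (j - 1) * a := by
    intro a
    rw [Finset.sum_const, Finset.card_univ, Fintype.card_fin, nsmul_eq_mul, hcast]
  have e1 : ∑ u : Fin (j - 1), excess R c (S (i - j + 1 + u)) (downSample R S i j d u) =
      ∑ u : Fin (j - 1), S (i - j + 1 + u) ^ 2
        - 2 * ∑ u : Fin (j - 1), S (i - j + 1 + u) * downSample R S i j d u
        + 2 * c * ∑ u, downSample R S i j d u - (j - 1) * (c ^ 2 + R) := by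
    rw [← hconst, Finset.mul_sum, Finset.mul_sum, ← Finset.sum_sub_distrib,
      ← Finset.sum_add_distrib, ← Finset.sum_sub_distrib]
    exact Finset.sum_congr rfl fun u _ => by unfold excess; ring
  have e2 : ∑ u : Fin (j - 1), (S (i - j + 1 + u) - s) *
        (S (i - j + 1 + u) + s - 2 * downSample R S i j d u) =
      ∑ u : Fin (j - 1), S (i - j + 1 + u) ^ 2
        - 2 * ∑ u : Fin (j - 1), S (i - j + 1 + u) * downSample R S i j d u
        + 2 * s * ∑ u, downSample R S i j d u - (j - 1) * s ^ 2 := by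
    rw [← hconst, Finset.mul_sum, Finset.mul_sum, ← Finset.sum_sub_distrib,
      ← Finset.sum_add_distrib, ← Finset.sum_sub_distrib]
    exact Finset.sum_congr rfl fun u _ => by ring
  have e3 : circleA R S i s j d = j * s - ∑ u, downSample R S i j d u := by
    unfold circleA
    rw [Finset.sum_sub_distrib, hconst]
    ring
  rw [e1, e3]
  unfold radicand
  rw [e2]
  unfold excess
  field_simp
  ring

/-- The bounds `a ± b` describe the up samples for which the circle has regret at most `R`. -/
theorem circle_iff {R : ℝ} {S : ℕ → ℝ} {i : ℕ} (s : ℝ) {j : ℕ} (hj : 1 ≤ j) (hji : j ≤ i)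
    (hS : ∀ l, 1 ≤ l → l < i → √R ≤ S l ∧ S l ≤ 1) {X : ℝ} (h0 : 0 ≤ X) (h1 : X ≤ 1) :
    (∀ c, 0 ≤ c → c ≤ 1 → circleExcess R S i s (j - 1) c X ≤ 0) ↔
      ∀ d, (X - circleA R S i s j d) ^ 2 ≤ (j : ℝ) ^ 2 * radicand R S i s j d := by
  have hj0 : (0 : ℝ) < j := by positivity
  unfold circleExcess
  simp only [sum_downExcess_eq _ _ S hji]
  constructor
  · intro h d
    set σ := X + ∑ u, downSample R S i j d u with hσ
    have hy : ∀ u : Fin (j - 1), 0 ≤ downSample R S i j d u ∧ downSample R S i j d u ≤ 1 := by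
      intro u
      have := hS (i - j + 1 + u) (by omega) (by omega)
      have := Real.sqrt_nonneg R
      unfold downSample
      split_ifs
      · simp
      · constructor <;> linarith
    have hs0 : 0 ≤ ∑ u, downSample R S i j d u := Finset.sum_nonneg fun u _ => (hy u).1
    have hs1 : ∑ u, downSample R S i j d u ≤ j - 1 := by
      have := Finset.sum_le_sum fun u (_ : u ∈ Finset.univ) => (hy u).2
      rw [Finset.sum_const, Finset.card_univ, Fintype.card_fin, nsmul_eq_mul, mul_one] at this
      push_cast [hj] at this
      exact this
    -- The excess is largest when `c` is the mean of the samples, which lies in `[0,1]`.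
    have hc := h (σ / j) (by positivity) (by rw [div_le_one hj0]; linarith)
    have hle : excess R (σ / j) s X +
        ∑ u : Fin (j - 1), excess R (σ / j) (S (i - j + 1 + u)) (downSample R S i j d u) ≤ 0 := by
      refine le_trans (add_le_add le_rfl (Finset.sum_le_sum fun u _ => ?_)) hc
      unfold downSample downExcess
      split_ifs
      · exact le_max_left _ _
      · exact le_max_right _ _
    have key := circle_square R S i s hj d (σ / j) X
    rw [mul_div_cancel₀ _ hj0.ne', ← hσ, sub_self] at key
    nlinarith [mul_nonpos_of_nonneg_of_nonpos hj0.le hle]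
  · intro h c _ _
    -- For each `c` the maxima in `downExcess` are attained by one combination of down samples.
    let d : Fin (j - 1) → Bool := fun u =>
      decide (excess R c (S (i - j + 1 + u)) (S (i - j + 1 + u) - √R) ≤
        excess R c (S (i - j + 1 + u)) 0)
    have hd : ∀ u : Fin (j - 1), downExcess R c (S (i - j + 1 + u)) =
        excess R c (S (i - j + 1 + u)) (downSample R S i j d u) := by
      intro u
      unfold downExcess downSample
      by_cases hle : excess R c (S (i - j + 1 + u)) (S (i - j + 1 + u) - √R) ≤
        excess R c (S (i - j + 1 + u)) 0
      · simp [d, hle]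
      · simp [d, hle, (not_le.1 hle).le]
    have key := circle_square R S i s hj d c X
    simp only [hd]
    have := h d
    by_contra! hcon
    nlinarith [mul_pos hj0 hcon, sq_nonneg (j * c - (X + ∑ u, downSample R S i j d u))]

theorem cLow_le_iff {R : ℝ} {S : ℕ → ℝ} {i : ℕ} {s : ℝ} {j : ℕ} {x : ℝ} :
    cLow R S i s j ≤ x ↔ ∀ d, circleA R S i s j d - circleB R S i s j d ≤ x :=
  ciSup_le_iff (Set.finite_range _).bddAbove

theorem le_cHigh_iff {R : ℝ} {S : ℕ → ℝ} {i : ℕ} {s : ℝ} {j : ℕ} {x : ℝ} :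
    x ≤ cHigh R S i s j ↔ ∀ d, x ≤ circleA R S i s j d + circleB R S i s j d :=
  le_ciInf_iff (Set.finite_range _).bddBelow

theorem sq_le_iff_circleB {R : ℝ} {S : ℕ → ℝ} {i : ℕ} {s : ℝ} {j : ℕ} (hj : 1 ≤ j)
    (d : Fin (j - 1) → Bool) (X : ℝ) :
    (X - circleA R S i s j d) ^ 2 ≤ (j : ℝ) ^ 2 * radicand R S i s j d ↔
      0 ≤ radicand R S i s j d ∧ circleA R S i s j d - circleB R S i s j d ≤ X ∧
        X ≤ circleA R S i s j d + circleB R S i s j d := by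
  have hj0 : (0 : ℝ) < j := by positivity
  unfold circleB
  constructor
  · intro h
    have h0 : 0 ≤ radicand R S i s j d := by
      by_contra! hcon
      nlinarith [mul_pos (sq_pos_of_pos hj0) (neg_pos.2 hcon), sq_nonneg (X - circleA R S i s j d)]
    rw [← Real.sq_sqrt h0, ← mul_pow] at h
    have := abs_le_of_sq_le_sq' h (by positivity)
    exact ⟨h0, by linarith, by linarith⟩
  · rintro ⟨h0, h1, h2⟩
    conv_rhs => rw [← Real.sq_sqrt h0, ← mul_pow]
    apply sq_le_sq'
    · linarith
    · linarith

theorem validThresholds_iff_feasible {R : ℝ} {S : ℕ → ℝ} {i : ℕ} {s : ℝ} {m : ℕ} {T : ℕ → ℝ}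
    (hm : 1 ≤ m) (hmi : m ≤ i - 1) (hS : ∀ l, 1 ≤ l → l < i → √R ≤ S l ∧ S l ≤ 1) :
    ValidThresholds R S i s m T ↔ Feasible R S i s m T := by
  constructor
  · intro h
    have hT : ∀ l, l ≤ m → 0 ≤ T l ∧ T l ≤ 1 := by
      intro l hl
      constructor
      · exact ((le_max_left _ _).trans_lt h.down_lt).le.trans
          (h.strictMono.monotoneOn (by simp) (by simpa using hl) (Nat.zero_le _))
      · rw [← h.top]
        exact h.strictMono.monotoneOn (by simpa using hl) (by simp) hl
    refine ⟨h.strictMono, h.down_lt, h.top, h.zero_le, fun J hJ => ?_⟩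
    have hlo : cLow R S i s (J + 2) ≤ T J := by
      rcases Nat.eq_zero_or_pos J with rfl | hJ0
      · exact h.low_zero
      · exact h.low_le (J + 1) (by omega) (by omega)
    have hhi : T (J + 1) ≤ cHigh R S i s (J + 2) := by
      rcases eq_or_lt_of_le (show J + 1 ≤ m from hJ) with rfl | hlt
      · exact h.top_le
      · exact h.le_high (J + 2) (by omega) (by omega)
    have hlt : T J < T (J + 1) := h.strictMono (by simp; omega) (by simp; omega) (by omega)
    rw [cLow_le_iff] at hlo
    rw [le_cHigh_iff] at hhi
    have hrad := h.radicand_nonneg (J + 2) (by omega) (by omega)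
    have k1 := (circle_iff s (j := J + 2) (by omega) (by omega) hS (hT J (by omega)).1
      (hT J (by omega)).2).2 fun d => (sq_le_iff_circleB (by omega) d _).2
        ⟨hrad d, hlo d, hlt.le.trans (hhi d)⟩
    have k2 := (circle_iff s (j := J + 2) (by omega) (by omega) hS (hT (J + 1) (by omega)).1
      (hT (J + 1) (by omega)).2).2 fun d => (sq_le_iff_circleB (by omega) d _).2
        ⟨hrad d, (hlo d).trans hlt.le, hhi d⟩
    exact fun c h0 h1 => ⟨k1 c h0 h1, k2 c h0 h1⟩
  · intro h
    have key1 : ∀ J, J < m → ∀ d, 0 ≤ radicand R S i s (J + 2) d ∧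
        circleA R S i s (J + 2) d - circleB R S i s (J + 2) d ≤ T J := by
      intro J hJ d
      have := h.mem_Icc (j := J) (by omega)
      have := (circle_iff s (j := J + 2) (by omega) (by omega) hS this.1.le this.2).1
        (fun c h0 h1 => (h.circle J hJ c h0 h1).1) d
      have := (sq_le_iff_circleB (by omega) d _).1 this
      exact ⟨this.1, this.2.1⟩
    have key2 : ∀ J, J < m → ∀ d,
        T (J + 1) ≤ circleA R S i s (J + 2) d + circleB R S i s (J + 2) d := by
      intro J hJ d
      have := h.mem_Icc (j := J + 1) (by omega)
      have := (circle_iff s (j := J + 2) (by omega) (by omega) hS this.1.le this.2).1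
        (fun c h0 h1 => (h.circle J hJ c h0 h1).2) d
      exact ((sq_le_iff_circleB (by omega) d _).1 this).2.2
    refine ⟨h.strictMono, h.down_lt, h.top, ?_, ?_, h.zero_le, ?_, ?_, ?_⟩
    · intro j h2 hj
      obtain ⟨J, rfl⟩ : ∃ J, j = J + 2 := ⟨j - 2, by omega⟩
      exact fun d => (key1 J (by omega) d).1
    · exact cLow_le_iff.2 fun d => (key1 0 (by omega) d).2
    · intro j h2 hj
      obtain ⟨J, rfl⟩ : ∃ J, j = J + 2 := ⟨j - 2, by omega⟩
      exact cLow_le_iff.2 fun d => (key1 (J + 1) (by omega) d).2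
    · intro j h2 hj
      obtain ⟨J, rfl⟩ : ∃ J, j = J + 2 := ⟨j - 2, by omega⟩
      exact le_cHigh_iff.2 fun d => key2 J (by omega) d
    · obtain ⟨J, rfl⟩ : ∃ J, m = J + 1 := ⟨m - 1, by omega⟩
      exact le_cHigh_iff.2 fun d => key2 J (by omega) d

/-! ### Existence of the least feasible value -/

/-- Feasibility with the strict inequalities between the thresholds weakened, a closed condition. -/
structure WeaklyFeasible (R : ℝ) (S : ℕ → ℝ) (i : ℕ) (s : ℝ) (m : ℕ) (T : ℕ → ℝ) : Prop where
  mono : ∀ J, J < m → T J ≤ T (J + 1)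
  nonneg : 0 ≤ T 0
  down_le : s - √R ≤ T 0
  top : T m = 1
  zero_le : T 0 ≤ s + √R
  circle : ∀ J, J < m → ∀ c, 0 ≤ c → c ≤ 1 →
    circleExcess R S i s (J + 1) c (T J) ≤ 0 ∧ circleExcess R S i s (J + 1) c (T (J + 1)) ≤ 0

theorem WeaklyFeasible.monotoneOn {R : ℝ} {S : ℕ → ℝ} {i : ℕ} {s : ℝ} {m : ℕ} {T : ℕ → ℝ}
    (h : WeaklyFeasible R S i s m T) {a b : ℕ} (hab : a ≤ b) (hb : b ≤ m) : T a ≤ T b := by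
  induction b, hab using Nat.le_induction with
  | base => exact le_rfl
  | succ b hab ih => exact (ih (by omega)).trans (h.mono b (by omega))

theorem Feasible.weaklyFeasible {R : ℝ} {S : ℕ → ℝ} {i : ℕ} {s : ℝ} {m : ℕ} {T : ℕ → ℝ}
    (h : Feasible R S i s m T) : WeaklyFeasible R S i s m T :=
  ⟨fun J hJ => (h.strictMono (by simp; omega) (by simp; omega) (by omega)).le,
    ((le_max_left _ _).trans_lt h.down_lt).le, ((le_max_right _ _).trans_lt h.down_lt).le, h.top,
    h.zero_le, h.circle⟩

theorem eventually_circleExcess_nonpos {R : ℝ} {S : ℕ → ℝ} {i : ℕ} {s : ℝ} {J : ℕ} {X : ℝ}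
    (h : ∀ c, 0 ≤ c → c ≤ 1 → circleExcess R S i s J c X < 0) :
    ∀ᶠ ε in 𝓝[>] (0 : ℝ), ∀ c, 0 ≤ c → c ≤ 1 → circleExcess R S i s J c (X + ε) ≤ 0 := by
  obtain ⟨c₀, hc₀, hmax⟩ := (isCompact_Icc (a := (0 : ℝ)) (b := 1)).exists_isMaxOn
    ⟨0, by simp⟩ (continuous_circleExcess R S i s J X).continuousOn
  have hneg := h c₀ hc₀.1 hc₀.2
  set η := -circleExcess R S i s J c₀ X with hη
  have hη0 : 0 < η := by linarith
  have hs : 0 < 2 * (1 + |s|) := by positivity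
  filter_upwards [Ioo_mem_nhdsGT (show (0 : ℝ) < η / (2 * (1 + |s|)) by positivity)]
    with ε hε c h0 h1
  have hm : circleExcess R S i s J c X ≤ circleExcess R S i s J c₀ X := hmax ⟨h0, h1⟩
  have hstep : circleExcess R S i s J c (X + ε) =
      circleExcess R S i s J c X + 2 * ε * (c - s) := by
    unfold circleExcess excess; ring
  have h3 : ε * (2 * (1 + |s|)) < η := (lt_div_iff₀ hs).1 hε.2
  have h4 : ε * (c - s) ≤ ε * (1 + |s|) :=
    mul_le_mul_of_nonneg_left (by linarith [neg_abs_le s]) hε.1.le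
  rw [hstep]
  linarith

/-- Thresholds that coincide with an earlier one can be raised together: the jumps between them
have room on both sides by `circleExcess_neg`. -/
theorem WeaklyFeasible.exists_raise {R : ℝ} (hR : 0 < R) {S : ℕ → ℝ} {i : ℕ} {s : ℝ} {m : ℕ}
    {T : ℕ → ℝ} (h : WeaklyFeasible R S i s m T) (hmi : m ≤ i - 1)
    (hS : ∀ l, 1 ≤ l → l < i → √R < S l) (hdec : ∀ l, 1 ≤ l → l + 1 < i → S (l + 1) < S l)
    (hlt : ∀ J, J < m → T J < 1) {l : ℕ} (hl : l < m) (h0 : l = 0 → T 0 < s + √R)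
    (hl1 : ∀ k, l = k + 1 → T k = T l) :
    ∃ T', WeaklyFeasible R S i s m T' ∧ (∀ J, J < m → T' J < 1) ∧ (∀ J, J < l → T' J = T J) ∧
      T l < T' l := by
  set τ := T l with hτ
  have hstrict : ∀ J, J + 1 < m → T J = τ → T (J + 1) = τ →
      ∀ c, 0 ≤ c → c ≤ 1 → circleExcess R S i s (J + 1) c τ < 0 := by
    intro J hJ e1 e2 c hc0 hc1
    refine circleExcess_neg hR hc0 ?_ ?_ (hS _ (by omega) (by omega)).le ?_
    · rcases J with _ | J
      · rw [circleExcess_zero, ← e1]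
        exact excess_nonpos hR.le h.down_le h.zero_le
      · rw [← e1]
        exact (h.circle J (by omega) c hc0 hc1).2
    · rw [← e2]
      exact (h.circle (J + 1) hJ c hc0 hc1).1
    · have := hdec (i - 1 - (J + 1)) (by omega) (by omega)
      rwa [show i - 1 - (J + 1) + 1 = i - 1 - J by omega] at this
  -- All thresholds from `l` on that equal `τ` are raised to `τ + ε`, for an `ε` that respects the
  -- larger thresholds, the value `1`, the circles of the collapsed jumps, and `s + √R`.
  have E1 : ∀ᶠ ε in 𝓝[>] (0 : ℝ), ∀ J ∈ Finset.range (m + 1), τ < T J → τ + ε ≤ T J := by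
    rw [Filter.eventually_all_finset]
    intro J _
    by_cases hJ : τ < T J
    · filter_upwards [Ioo_mem_nhdsGT (sub_pos.2 hJ)] with ε hε _
      linarith [hε.2]
    · exact Filter.Eventually.of_forall fun ε h' => absurd h' hJ
  have E2 : ∀ᶠ ε in 𝓝[>] (0 : ℝ), τ + ε < 1 := by
    filter_upwards [Ioo_mem_nhdsGT (sub_pos.2 (hlt l hl))] with ε hε
    linarith [hε.2]
  have E3 : ∀ᶠ ε in 𝓝[>] (0 : ℝ), ∀ J ∈ Finset.range m, J + 1 < m → T J = τ → T (J + 1) = τ →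
      ∀ c, 0 ≤ c → c ≤ 1 → circleExcess R S i s (J + 1) c (τ + ε) ≤ 0 := by
    rw [Filter.eventually_all_finset]
    intro J _
    by_cases hJ : J + 1 < m ∧ T J = τ ∧ T (J + 1) = τ
    · filter_upwards [eventually_circleExcess_nonpos (hstrict J hJ.1 hJ.2.1 hJ.2.2)]
        with ε hε _ _ _ using hε
    · exact Filter.Eventually.of_forall fun ε a b c => absurd ⟨a, b, c⟩ hJ
  have E4 : ∀ᶠ ε in 𝓝[>] (0 : ℝ), l = 0 → τ + ε ≤ s + √R := by
    by_cases hl0 : l = 0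
    · have hpos : 0 < s + √R - τ := by rw [hτ, hl0]; linarith [h0 hl0]
      filter_upwards [Ioo_mem_nhdsGT hpos] with ε hε _
      linarith [hε.2]
    · exact Filter.Eventually.of_forall fun ε h' => absurd h' hl0
  obtain ⟨ε, ⟨⟨⟨⟨e1, e2⟩, e3⟩, e4⟩, hε⟩⟩ :=
    ((((E1.and E2).and E3).and E4).and self_mem_nhdsWithin).exists
  have hε : 0 < ε := hε
  have hge : ∀ J, l ≤ J → J ≤ m → τ ≤ T J := fun J h1 h2 => h.monotoneOn h1 h2
  have hraise : ∀ J, τ ≤ T J → J ≤ m → (T J = τ ∧ max (T J) (τ + ε) = τ + ε) ∨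
      (τ < T J ∧ max (T J) (τ + ε) = T J) := by
    intro J h1 h2
    rcases eq_or_lt_of_le h1 with h3 | h3
    · exact Or.inl ⟨h3.symm, max_eq_right (by linarith)⟩
    · exact Or.inr ⟨h3, max_eq_left (e1 J (Finset.mem_range.2 (by omega)) h3)⟩
  refine ⟨fun J => if l ≤ J then max (T J) (τ + ε) else T J, ⟨?_, ?_, ?_, ?_, ?_, ?_⟩, ?_, ?_, ?_⟩
  · intro J hJ
    have := h.mono J hJ
    by_cases h1 : l ≤ J
    · simp only [h1, show l ≤ J + 1 by omega, if_true]
      exact max_le_max_right _ this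
    · simp only [h1, if_false]
      split_ifs
      · exact this.trans (le_max_left _ _)
      · exact this
  · have := h.nonneg
    show 0 ≤ if l ≤ 0 then max (T 0) (τ + ε) else T 0
    split_ifs
    · exact this.trans (le_max_left _ _)
    · exact this
  · have := h.down_le
    show s - √R ≤ if l ≤ 0 then max (T 0) (τ + ε) else T 0
    split_ifs
    · exact this.trans (le_max_left _ _)
    · exact this
  · show (if l ≤ m then max (T m) (τ + ε) else T m) = 1
    rw [if_pos hl.le, h.top, max_eq_left e2.le]
  · show (if l ≤ 0 then max (T 0) (τ + ε) else T 0) ≤ s + √R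
    split_ifs with h1
    · exact max_le h.zero_le (e4 (by omega))
    · exact h.zero_le
  · intro J hJ c hc0 hc1
    have hold := h.circle J hJ c hc0 hc1
    show circleExcess R S i s (J + 1) c (if l ≤ J then max (T J) (τ + ε) else T J) ≤ 0 ∧
      circleExcess R S i s (J + 1) c (if l ≤ J + 1 then max (T (J + 1)) (τ + ε) else T (J + 1)) ≤ 0
    rcases lt_trichotomy (J + 1) l with hJl | hJl | hJl
    · rw [if_neg (by omega), if_neg (by omega)]
      exact hold
    · have hT : T J = τ := hl1 J hJl.symm
      have hT1 : T (J + 1) = τ := by rw [hJl]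
      rw [if_neg (by omega), if_pos hJl.ge, hT1, max_eq_right (by linarith)]
      exact ⟨hold.1, e3 J (Finset.mem_range.2 hJ) (by omega) hT hT1 c hc0 hc1⟩
    · rw [if_pos (by omega), if_pos (by omega)]
      have hmJ := h.mono J hJ
      rcases hraise (J + 1) (hge _ (by omega) hJ) hJ with ⟨h1, h2⟩ | ⟨h1, h2⟩
      · have h3 : T J = τ := le_antisymm (hmJ.trans_eq h1) (hge J (by omega) hJ.le)
        have hJm : J + 1 < m := by
          rcases eq_or_lt_of_le (show J + 1 ≤ m from hJ) with h4 | h4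
          · rw [h4, h.top] at h1
            linarith
          · exact h4
        have := e3 J (Finset.mem_range.2 hJ) hJm h3 h1 c hc0 hc1
        rw [h2, h3, max_eq_right (by linarith)]
        exact ⟨this, this⟩
      · rw [h2]
        refine ⟨circleExcess_nonpos_of_mem hold.1 hold.2 (le_max_left _ _) (max_le hmJ ?_), hold.2⟩
        exact e1 (J + 1) (Finset.mem_range.2 (by omega)) h1
  · intro J hJ
    show (if l ≤ J then max (T J) (τ + ε) else T J) < 1
    split_ifs
    · exact max_lt (hlt J hJ) e2
    · exact hlt J hJ
  · intro J hJ
    simp [show ¬ l ≤ J by omega]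
  · simp only [le_refl, if_true]
    exact lt_max_of_lt_right (by linarith)

theorem WeaklyFeasible.neg_sqrt_lt {R : ℝ} (hR : 0 < R) {S : ℕ → ℝ} {i : ℕ} {s : ℝ} {m : ℕ}
    {T : ℕ → ℝ} (h : WeaklyFeasible R S i s m T) (hm : 1 ≤ m) (hS : √R < S (i - 1)) :
    -√R < s := by
  by_contra! hcon
  have h0 : T 0 = 0 := le_antisymm (by linarith [h.zero_le]) h.nonneg
  have hs : s = -√R := le_antisymm hcon (by linarith [h.zero_le, h.nonneg])
  have hr := Real.sq_sqrt hR.le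
  have hr0 := Real.sqrt_pos.2 hR
  have := (h.circle 0 hm 0 le_rfl zero_le_one).1
  rw [circleExcess_succ, circleExcess_zero, h0, Nat.sub_zero,
    downExcess_of_le hR.le hS.le (hr0.trans hS).le, hs] at this
  unfold excess at this
  nlinarith

theorem WeaklyFeasible.exists_feasible {R : ℝ} (hR : 0 < R) {S : ℕ → ℝ} {i : ℕ} {s : ℝ} {m : ℕ}
    {T : ℕ → ℝ} (h : WeaklyFeasible R S i s m T) (hm : 1 ≤ m) (hmi : m ≤ i - 1)
    (hS : ∀ l, 1 ≤ l → l < i → √R < S l) (hdec : ∀ l, 1 ≤ l → l + 1 < i → S (l + 1) < S l)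
    (hs : s + √R < 1) :
    ∃ m' T', 1 ≤ m' ∧ m' ≤ i - 1 ∧ Feasible R S i s m' T' := by
  classical
  have hr0 := Real.sqrt_pos.2 hR
  have hsr := h.neg_sqrt_lt hR hm (hS _ (by omega) (by omega))
  -- Jumps beyond the first threshold equal to `1` are not needed.
  have hex : ∃ J, T J = 1 := ⟨m, h.top⟩
  set n := Nat.find hex with hn
  have hn1 : T n = 1 := Nat.find_spec hex
  have hnm : n ≤ m := Nat.find_min' hex h.top
  have hn0 : 1 ≤ n := by
    by_contra! hcon
    have : n = 0 := by omega
    rw [this] at hn1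
    linarith [h.zero_le]
  have hw : WeaklyFeasible R S i s n T :=
    ⟨fun J hJ => h.mono J (by omega), h.nonneg, h.down_le, hn1, h.zero_le,
      fun J hJ => h.circle J (by omega)⟩
  have hlt : ∀ J, J < n → T J < 1 := fun J hJ =>
    lt_of_le_of_ne ((h.monotoneOn (by omega) le_rfl).trans_eq h.top) (Nat.find_min hex hJ)
  have key : ∀ l, l ≤ n → ∃ T', WeaklyFeasible R S i s n T' ∧ (∀ J, J < n → T' J < 1) ∧
      max 0 (s - √R) < T' 0 ∧ ∀ J, J < l → T' J < T' (J + 1) := by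
    intro l
    induction l with
    | zero =>
      intro _
      by_cases h0 : max 0 (s - √R) < T 0
      · exact ⟨T, hw, hlt, h0, by simp⟩
      · have hge : max 0 (s - √R) ≤ T 0 := max_le h.nonneg h.down_le
        have heq : T 0 = max 0 (s - √R) := le_antisymm (not_lt.1 h0) hge
        obtain ⟨T', a, b, _, d⟩ := hw.exists_raise hR (by omega) hS hdec hlt (l := 0) (by omega)
          (fun _ => by rw [heq]; exact max_lt (by linarith) (by linarith)) (by simp)
        exact ⟨T', a, b, hge.trans_lt d, by simp⟩
    | succ l ih =>
      intro hl
      obtain ⟨T₁, a, b, c, d⟩ := ih (by omega)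
      by_cases hlast : T₁ l < T₁ (l + 1)
      · refine ⟨T₁, a, b, c, fun J hJ => ?_⟩
        rcases eq_or_lt_of_le (Nat.lt_succ_iff.1 hJ) with rfl | hJ
        · exact hlast
        · exact d J hJ
      · have heq : T₁ l = T₁ (l + 1) := le_antisymm (a.mono l (by omega)) (not_lt.1 hlast)
        have hl' : l + 1 < n := by
          rcases eq_or_lt_of_le hl with h4 | h4
          · have := b l (by omega)
            rw [heq, h4, a.top] at this
            exact absurd this (lt_irrefl _)
          · exact h4
        obtain ⟨T', a', b', c', d'⟩ := a.exists_raise hR (by omega) hS hdec b hl' (by simp)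
          (fun k hk => by rw [← show l = k by omega]; exact heq)
        refine ⟨T', a', b', by rw [c' 0 (by omega)]; exact c, fun J hJ => ?_⟩
        rcases eq_or_lt_of_le (Nat.lt_succ_iff.1 hJ) with rfl | hJ
        · rw [c' J (by omega), heq]
          exact d'
        · rw [c' J (by omega), c' (J + 1) (by omega)]
          exact d J hJ
  obtain ⟨T', a, _, c, d⟩ := key n le_rfl
  refine ⟨n, T', hn0, by omega, ?_, c, a.top, a.zero_le, a.circle⟩
  intro x hx y hy hxy
  simp only [Set.mem_Iic] at hx hy
  clear hx
  induction y, (show x + 1 ≤ y from hxy) using Nat.le_induction with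
  | base => exact d x (by omega)
  | succ y hxy' ih => exact (ih (by omega) (by omega)).trans (d y (by omega))

/-- The value required by the algorithm exists as soon as some value is feasible. -/
theorem exists_least_feasible {R : ℝ} (hR : 0 < R) {S : ℕ → ℝ} {i : ℕ} (hi : 2 ≤ i)
    (hS : ∀ l, 1 ≤ l → l < i → √R < S l) (hdec : ∀ l, 1 ≤ l → l + 1 < i → S (l + 1) < S l)
    (hhalf : S (i - 1) ≤ 1 / 2) {s₁ : ℝ} {m₁ : ℕ} {T₁ : ℕ → ℝ} (hs₁ : s₁ < S (i - 1))
    (hm₁ : 1 ≤ m₁) (hmi₁ : m₁ ≤ i - 1) (h₁ : Feasible R S i s₁ m₁ T₁) :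
    ∃ s m T, s < S (i - 1) ∧ 1 ≤ m ∧ m ≤ i - 1 ∧ Feasible R S i s m T ∧
      ∀ s' m' T', s' < S (i - 1) → 1 ≤ m' → m' ≤ i - 1 → Feasible R S i s' m' T' → s ≤ s' := by
  have hr0 := Real.sqrt_pos.2 hR
  have hlast := hS (i - 1) (by omega) (by omega)
  let K : ℕ → Set (ℝ × (ℕ → ℝ)) := fun m =>
    {p | p.1 ∈ Set.Icc (-√R) 1 ∧ p.2 ∈ Set.univ.pi (fun _ => Set.Icc (0 : ℝ) 1) ∧
      WeaklyFeasible R S i p.1 m p.2}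
  have hK : ∀ m, IsCompact (K m) := by
    intro m
    have hbox : IsCompact (Set.Icc (-√R) 1 ×ˢ Set.univ.pi (fun _ : ℕ => Set.Icc (0 : ℝ) 1)) :=
      isCompact_Icc.prod (isCompact_univ_pi fun _ => isCompact_Icc)
    have hcl : IsClosed {p : ℝ × (ℕ → ℝ) | WeaklyFeasible R S i p.1 m p.2} := by
      have heq : {p : ℝ × (ℕ → ℝ) | WeaklyFeasible R S i p.1 m p.2} =
          {p | (∀ J, J < m → p.2 J ≤ p.2 (J + 1)) ∧ 0 ≤ p.2 0 ∧ p.1 - √R ≤ p.2 0 ∧ p.2 m = 1 ∧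
            p.2 0 ≤ p.1 + √R ∧ ∀ J, J < m → ∀ c, 0 ≤ c → c ≤ 1 →
              circleExcess R S i p.1 (J + 1) c (p.2 J) ≤ 0 ∧
                circleExcess R S i p.1 (J + 1) c (p.2 (J + 1)) ≤ 0} := by
        ext p
        exact ⟨fun h => ⟨h.1, h.2, h.3, h.4, h.5, h.6⟩,
          fun ⟨a, b, c, d, e, f⟩ => ⟨a, b, c, d, e, f⟩⟩
      rw [heq]
      simp only [Set.ofPred_and, Set.ofPred_forall]
      have hc : ∀ J c l, Continuous fun p : ℝ × (ℕ → ℝ) =>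
          circleExcess R S i p.1 (J + 1) c (p.2 l) := by
        intro J c l
        unfold circleExcess excess
        fun_prop
      refine IsClosed.inter (isClosed_iInter fun J => isClosed_iInter fun _ => ?_)
        (IsClosed.inter ?_ (IsClosed.inter ?_ (IsClosed.inter ?_ (IsClosed.inter ?_
          (isClosed_iInter fun J => isClosed_iInter fun _ => isClosed_iInter fun c =>
            isClosed_iInter fun _ => isClosed_iInter fun _ => IsClosed.inter ?_ ?_)))))
      · exact isClosed_le (by fun_prop) (by fun_prop)
      · exact isClosed_le (by fun_prop) (by fun_prop)
      · exact isClosed_le (by fun_prop) (by fun_prop)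
      · exact isClosed_eq (by fun_prop) (by fun_prop)
      · exact isClosed_le (by fun_prop) (by fun_prop)
      · exact isClosed_le (hc J c J) continuous_const
      · exact isClosed_le (hc J c (J + 1)) continuous_const
    have : K m = (Set.Icc (-√R) 1 ×ˢ Set.univ.pi (fun _ : ℕ => Set.Icc (0 : ℝ) 1)) ∩
        {p | WeaklyFeasible R S i p.1 m p.2} := by
      ext p
      simp only [K, Set.mem_ofPred_eq, Set.mem_inter_iff, Set.mem_prod, and_assoc]
    rw [this]
    exact hbox.inter_right hcl
  have hU : IsCompact (⋃ m ∈ Finset.Icc 1 (i - 1), Prod.fst '' K m) :=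
    (Finset.Icc 1 (i - 1)).isCompact_biUnion fun m _ => (hK m).image continuous_fst
  have hmem : ∀ s m T, s < S (i - 1) → 1 ≤ m → m ≤ i - 1 → Feasible R S i s m T →
      s ∈ ⋃ m ∈ Finset.Icc 1 (i - 1), Prod.fst '' K m := by
    intro s m T hs hm hmi h
    simp only [Set.mem_iUnion, Finset.mem_Icc]
    have hmin : ∀ J, J ≤ m → min J m = J := fun J hJ => min_eq_left hJ
    refine ⟨m, ⟨hm, hmi⟩, (s, fun l => T (min l m)), ⟨⟨?_, ?_⟩, ?_, ?_⟩, rfl⟩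
    · exact (h.weaklyFeasible.neg_sqrt_lt hR hm hlast).le
    · show s ≤ 1
      linarith
    · intro l _
      have := h.mem_Icc (min_le_right l m)
      exact ⟨this.1.le, this.2⟩
    · have hw := h.weaklyFeasible
      refine ⟨fun J hJ => ?_, ?_, ?_, ?_, ?_, fun J hJ => ?_⟩
      · simpa only [hmin J hJ.le, hmin (J + 1) hJ] using hw.mono J hJ
      · simpa using hw.nonneg
      · simpa using hw.down_le
      · simpa using hw.top
      · simpa using hw.zero_le
      · simpa only [hmin J hJ.le, hmin (J + 1) hJ] using hw.circle J hJ
  obtain ⟨s, hsU, hsmin⟩ := hU.exists_isLeast ⟨s₁, hmem s₁ m₁ T₁ hs₁ hm₁ hmi₁ h₁⟩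
  have hss₁ : s ≤ s₁ := hsmin (hmem s₁ m₁ T₁ hs₁ hm₁ hmi₁ h₁)
  simp only [Set.mem_iUnion, Finset.mem_Icc] at hsU
  obtain ⟨m, ⟨hm, hmi⟩, ⟨s', T⟩, ⟨_, _, hw⟩, rfl⟩ := hsU
  obtain ⟨m', T', a, b, c⟩ := hw.exists_feasible hR hm hmi hS hdec (by simp only; linarith)
  exact ⟨s', m', T', by simp only at hss₁; linarith, a, b, c,
    fun s m T h1 h2 h3 h4 => hsmin (hmem s m T h1 h2 h3 h4)⟩

/-! ### Feasible values below a given state -/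

theorem add_downExcess_le {R c v κ : ℝ} (hR : 0 < R) (hv : √R ≤ v) :
    2 * κ * (c - v) + downExcess R c v ≤
      -min (√R ^ 2 - (v - κ) ^ 2) (√R ^ 2 - (κ - √R) ^ 2) := by
  have hs := Real.sq_sqrt hR.le
  rcases le_total c v with h | h
  · rw [downExcess_of_le hR.le hv h]
    have := min_le_left (√R ^ 2 - (v - κ) ^ 2) (√R ^ 2 - (κ - √R) ^ 2)
    nlinarith [sq_nonneg (c - κ)]
  · rw [downExcess_of_ge hR.le hv h]
    have := min_le_right (√R ^ 2 - (v - κ) ^ 2) (√R ^ 2 - (κ - √R) ^ 2)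
    nlinarith [sq_nonneg (c - v - (κ - √R))]

theorem circleExcess_succ_index (R : ℝ) (S : ℕ → ℝ) {i : ℕ} (hi : 1 ≤ i) (s : ℝ) (J : ℕ)
    (c X κ : ℝ) : circleExcess R S (i + 1) s (J + 1) c (X + κ) =
      circleExcess R S i (S i) J c X + (2 * κ * (c - S i) + downExcess R c (S i)) +
        (S i - s) * (2 * (X + κ) - s - S i) := by
  unfold circleExcess
  rw [Finset.sum_range_succ']
  have : ∀ t, i + 1 - 1 - (t + 1) = i - 1 - t := fun t => by omega
  simp only [this]
  rw [show i + 1 - 1 - 0 = i by omega]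
  unfold excess
  ring

/-- Below a state with value `v < 3√R` there is always room for another state. A new state just
below `v` can jump by `J + 1` states on the samples on which state `i` jumps by `J` states, shifted
up by some `κ` with `v - √R < κ < 2√R`; the shift makes the constraints strict. -/
theorem exists_feasible_below {R : ℝ} (hR : 0 < R) {S : ℕ → ℝ} {i : ℕ} (hi : 1 ≤ i) {m : ℕ}
    {T : ℕ → ℝ} (hmi : m ≤ i - 1) (hv : √R < S i) (hv1 : S i + √R < 1)
    (hmono : StrictMonoOn T (Set.Iic m)) (hT0 : S i - √R < T 0) (hT0' : T 0 ≤ S i + √R)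
    (hTm : ∀ J, J ≤ m → T J ≤ 1)
    (hcirc : ∀ J, J < m → ∀ c, 0 ≤ c → c ≤ 1 → circleExcess R S i (S i) (J + 1) c (T J) ≤ 0 ∧
      circleExcess R S i (S i) (J + 1) c (T (J + 1)) ≤ 0)
    {κ : ℝ} (hκ1 : S i - √R < κ) (hκ2 : κ < 2 * √R) (hκ3 : 1 ≤ T m + κ) :
    ∃ s m' T', s < S i ∧ 1 ≤ m' ∧ m' ≤ i ∧ Feasible R S (i + 1) s m' T' := by
  classical
  have hr0 := Real.sqrt_pos.2 hR
  have hs := Real.sq_sqrt hR.le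
  set v := S i with hvdef
  -- With the additional threshold `v - √R`, the jump by `0` states is treated like the others.
  let U : ℕ → ℝ := fun J => Nat.casesOn J (v - √R) T
  have hU0 : U 0 = v - √R := rfl
  have hU1 : ∀ J, U (J + 1) = T J := fun J => rfl
  have hUmono : ∀ J, J ≤ m → U J < U (J + 1) := by
    intro J hJ
    rcases J with _ | J
    · exact hT0
    · exact hmono (by simp; omega) (by simpa using hJ) (by omega)
  have hUle : ∀ J, J ≤ m + 1 → U J ≤ 1 := by
    intro J hJ
    rcases J with _ | J
    · rw [hU0]; linarith
    · exact hTm J (by omega)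
  have hUc : ∀ J, J ≤ m → ∀ c, 0 ≤ c → c ≤ 1 → circleExcess R S i v J c (U J) ≤ 0 ∧
      circleExcess R S i v J c (U (J + 1)) ≤ 0 := by
    intro J hJ c h0 h1
    rcases J with _ | J
    · rw [circleExcess_zero, circleExcess_zero]
      exact ⟨excess_nonpos hR.le (by rw [hU0]) (by rw [hU0]; linarith),
        excess_nonpos hR.le (by rw [hU1]; linarith) hT0'⟩
    · exact hcirc J hJ c h0 h1
  set η := min (√R ^ 2 - (v - κ) ^ 2) (√R ^ 2 - (κ - √R) ^ 2) with hη
  have hη0 : 0 < η := by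
    refine lt_min ?_ ?_
    · nlinarith
    · nlinarith
  obtain ⟨ε, hε0, hε⟩ : ∃ ε, 0 < ε ∧ ε ≤ min (min 1 (2 * √R - κ)) (η / 8) :=
    ⟨_, lt_min (lt_min one_pos (by linarith)) (by linarith), le_rfl⟩
  have hε1 : ε ≤ 1 := hε.trans ((min_le_left _ _).trans (min_le_left _ _))
  have hε2 : ε ≤ 2 * √R - κ := hε.trans ((min_le_left _ _).trans (min_le_right _ _))
  have hε3 : ε ≤ η / 8 := hε.trans (min_le_right _ _)
  have hnew : ∀ J, J ≤ m → ∀ c, 0 ≤ c → c ≤ 1 → ∀ X, X ≤ 1 → circleExcess R S i v J c X ≤ 0 →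
      circleExcess R S (i + 1) (v - ε) (J + 1) c (X + κ) ≤ 0 := by
    intro J hJ c h0 h1 X hX h
    rw [circleExcess_succ_index R S hi, ← hvdef]
    have h2 := add_downExcess_le (c := c) (κ := κ) hR hv.le
    have h3 : (v - (v - ε)) * (2 * (X + κ) - (v - ε) - v) ≤ ε * 8 := by
      have : 2 * (X + κ) - (v - ε) - v ≤ 8 := by linarith
      rw [show v - (v - ε) = ε by ring]
      exact mul_le_mul_of_nonneg_left this hε0.le
    linarith
  -- The shifted thresholds are cut off at the first one that reaches `1`.
  have hex : ∃ J, 1 ≤ U J + κ := ⟨m + 1, hκ3⟩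
  set n := Nat.find hex with hn
  have hn1 : 1 ≤ U n + κ := Nat.find_spec hex
  have hnm : n ≤ m + 1 := Nat.find_min' hex hκ3
  have hlt : ∀ J, J < n → U J + κ < 1 := fun J hJ => not_le.1 (Nat.find_min hex hJ)
  have hn0 : 1 ≤ n := by
    by_contra! hcon
    have h0 : n = 0 := by omega
    rw [h0, hU0] at hn1
    linarith
  have hT'0 : min (U 0 + κ) 1 = v - √R + κ := min_eq_left (hlt 0 hn0).le
  refine ⟨v - ε, n, fun J => min (U J + κ) 1, by linarith, hn0, by omega, ?_, ?_, ?_, ?_, ?_⟩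
  · have hstep : ∀ J, J < n → min (U J + κ) 1 < min (U (J + 1) + κ) 1 := by
      intro J hJ
      have := hUmono J (by omega)
      exact lt_min ((min_le_left _ _).trans_lt (by linarith))
        ((min_le_left _ _).trans_lt (hlt J hJ))
    intro x _ y hy hxy
    simp only [Set.mem_Iic] at hy
    induction y, (show x + 1 ≤ y from hxy) using Nat.le_induction with
    | base => exact hstep x (by omega)
    | succ y hxy' ih => exact (ih (by omega) (by omega)).trans (hstep y (by omega))
  · show max 0 (v - ε - √R) < min (U 0 + κ) 1
    rw [hT'0]
    exact max_lt (by linarith) (by linarith)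
  · exact min_eq_right hn1
  · show min (U 0 + κ) 1 ≤ v - ε + √R
    rw [hT'0]
    linarith
  · intro J hJ c h0 h1
    have hc := hUc J (by omega) c h0 h1
    have k1 := hnew J (by omega) c h0 h1 _ (hUle J (by omega)) hc.1
    have k2 := hnew J (by omega) c h0 h1 _ (hUle (J + 1) (by omega)) hc.2
    have := hUmono J (by omega)
    show circleExcess R S (i + 1) (v - ε) (J + 1) c (min (U J + κ) 1) ≤ 0 ∧
      circleExcess R S (i + 1) (v - ε) (J + 1) c (min (U (J + 1) + κ) 1) ≤ 0
    rw [min_eq_left (hlt J hJ).le]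
    exact ⟨k1, circleExcess_nonpos_of_mem k1 k2 (le_min (by linarith) (hlt J hJ).le)
      (min_le_left _ _)⟩

/-! ### Runs of the algorithm -/

section Run

variable {R : ℝ} {κ : Kind} {i : ℕ} {P : Placement}

theorem IsRun.sqrt_lt (h : IsRun R κ i P) {l : ℕ} (h1 : 1 ≤ l) (hl : l < i) : √R < P.S l := by
  have := (h.step (l + 1) (by omega) (by omega)).1
  rwa [Nat.add_sub_cancel] at this

theorem IsRun.succ_lt (h : IsRun R κ i P) {l : ℕ} (h1 : 1 ≤ l) (hl : l + 1 ≤ i) :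
    P.S (l + 1) < P.S l := by
  have := (h.step (l + 1) (by omega) (by omega)).2.lt
  rwa [Nat.add_sub_cancel] at this

theorem IsRun.lt_of_lt (h : IsRun R κ i P) {a b : ℕ} (h1 : 1 ≤ a) (hab : a < b) (hb : b ≤ i) :
    P.S b < P.S a := by
  induction b, (show a + 1 ≤ b from hab) using Nat.le_induction with
  | base => exact h.succ_lt h1 hb
  | succ b hab' ih => exact (h.succ_lt (by omega) hb).trans (ih (by omega) (by omega))

theorem IsRun.first_le_half (h : IsRun R κ i P) : P.S 1 ≤ 1 / 2 := by
  cases κ with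
  | odd => rw [h.start_eq]; exact le_rfl
  | even => exact (h.start_lt rfl).le

theorem IsRun.le_half (h : IsRun R κ i P) {l : ℕ} (h1 : 1 ≤ l) (hl : l ≤ i) : P.S l ≤ 1 / 2 := by
  rcases eq_or_lt_of_le h1 with rfl | h2
  · exact h.first_le_half
  · exact (h.lt_of_lt le_rfl h2 hl).le.trans h.first_le_half

theorem IsRun.bounds (h : IsRun R κ i P) {n : ℕ} (hn : n ≤ i) :
    ∀ l, 1 ≤ l → l < n → √R ≤ P.S l ∧ P.S l ≤ 1 := fun l h1 h2 =>
  ⟨(h.sqrt_lt h1 (by omega)).le, by linarith [h.le_half h1 (show l ≤ i by omega)]⟩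

theorem IsRun.feasible (h : IsRun R κ i P) {l : ℕ} (h2 : 2 ≤ l) (hl : l ≤ i) :
    Feasible R P.S l (P.S l) (P.m l) (P.T l) :=
  let hs := (h.step l h2 hl).2
  (validThresholds_iff_feasible hs.one_le hs.le (h.bounds hl)).1 hs.valid

theorem IsRun.le_of_feasible (h : IsRun R κ i P) {l : ℕ} (h2 : 2 ≤ l) (hl : l ≤ i) {s : ℝ} {m : ℕ}
    {T : ℕ → ℝ} (hs : s < P.S (l - 1)) (hm : 1 ≤ m) (hml : m ≤ l - 1)
    (hf : Feasible R P.S l s m T) : P.S l ≤ s :=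
  (h.step l h2 hl).2.least s m T hs hm hml
    ((validThresholds_iff_feasible hm hml (h.bounds hl)).2 hf)

theorem start_even_add_gt (hR : 0 < R) (h6 : 1 / 6 < √R) : 1 < start R .even + 3 * √R := by
  have hs := Real.sq_sqrt hR.le
  have h1 : √(R + √R + 1 / 2) < (1 + 4 * √R) / 2 := by
    rw [Real.sqrt_lt' (by linarith)]
    nlinarith
  have h2 : 2 + √R - 2 * √(R + √R + 1 / 2) ≤ start R .even := le_max_right _ _
  linarith

/-- A run that has not stopped can be continued. -/
theorem IsRun.exists_succ (hR : 0 < R) (h6 : 1 / 6 < √R) (h : IsRun R κ i P) (hi : √R < P.S i) :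
    ∃ P' : Placement, IsRun R κ (i + 1) P' ∧
      ∀ l ≤ i, P'.S l = P.S l ∧ P'.m l = P.m l ∧ P'.T l = P.T l := by
  classical
  have hone := h.one_le
  have hhalf := h.le_half hone le_rfl
  have hex : ∃ s m T, s < P.S i ∧ 1 ≤ m ∧ m ≤ i ∧ Feasible R P.S (i + 1) s m T := by
    rcases eq_or_lt_of_le hone with h1 | h2
    · subst h1
      have h3 : 1 < P.S 1 + 3 * √R := by
        rw [h.start_eq]
        cases κ with
        | odd => simp only [start]; linarith
        | even => exact start_even_add_gt hR h6
      obtain ⟨t, ht1, ht2⟩ := exists_between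
        (show max (P.S 1 - √R) (1 - P.S 1 - √R) < 2 * √R from max_lt (by linarith) (by linarith))
      have ht3 := (le_max_left _ _).trans_lt ht1
      have ht4 := (le_max_right _ _).trans_lt ht1
      exact exists_feasible_below hR le_rfl (m := 0) (T := fun _ => P.S 1 + √R) (by simp) hi
        (by linarith) (fun x hx y hy hxy => by simp only [Set.mem_Iic] at hx hy; omega)
        (by linarith) le_rfl (fun _ _ => by linarith) (fun J hJ => absurd hJ (by simp))
        ht3 ht2 (by linarith)
    · have hs := (h.step i h2 le_rfl).2
      have hf := h.feasible h2 le_rfl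
      obtain ⟨t, ht1, ht2⟩ := exists_between (show P.S i - √R < 2 * √R by linarith)
      exact exists_feasible_below hR hone hs.le hi (by linarith) hf.strictMono
        ((le_max_right _ _).trans_lt hf.down_lt) hf.zero_le (fun J hJ => (hf.mem_Icc hJ).2)
        hf.circle ht1 ht2 (by rw [hf.top]; linarith)
  obtain ⟨s₁, m₁, T₁, hs₁, hm₁, hmi₁, hf₁⟩ := hex
  have hbig : ∀ l, 1 ≤ l → l < i + 1 → √R < P.S l := by
    intro l h1 hl
    rcases eq_or_lt_of_le (Nat.lt_succ_iff.1 hl) with rfl | hl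
    · exact hi
    · exact h.sqrt_lt h1 hl
  obtain ⟨s, m, T, hs, hm, hmi, hf, hmin⟩ := exists_least_feasible hR (i := i + 1) (by omega) hbig
    (fun l h1 hl => h.succ_lt h1 (by omega)) (by simpa using hhalf) (s₁ := s₁) (by simpa using hs₁)
    hm₁ (by simpa using hmi₁) hf₁
  rw [Nat.add_sub_cancel] at hs hmi hmin
  let P' : Placement :=
    ⟨Function.update P.S (i + 1) s, Function.update P.m (i + 1) m, Function.update P.T (i + 1) T⟩
  have hagree : ∀ l ≤ i, P'.S l = P.S l ∧ P'.m l = P.m l ∧ P'.T l = P.T l := by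
    intro l hl
    have hne : l ≠ i + 1 := by omega
    simp [P', Function.update_of_ne hne]
  have hS' : P'.S (i + 1) = s := by simp [P']
  have hm' : P'.m (i + 1) = m := by simp [P']
  have hT' : P'.T (i + 1) = T := by simp [P']
  have hto : ∀ l, l ≤ i + 1 → ∀ s m T, m ≤ l - 1 → Feasible R P.S l s m T →
      Feasible R P'.S l s m T := fun l hl s m T hml hf =>
    hf.of_le hR hml fun a h1 ha => by
      rw [(hagree a (by omega)).1]; exact ⟨(hbig a h1 (by omega)).le, le_rfl⟩
  have hfrom : ∀ l, l ≤ i + 1 → ∀ s m T, m ≤ l - 1 → Feasible R P'.S l s m T →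
      Feasible R P.S l s m T := fun l hl s m T hml hf =>
    hf.of_le hR hml fun a h1 ha => by
      rw [(hagree a (by omega)).1]; exact ⟨(hbig a h1 (by omega)).le, le_rfl⟩
  have hbounds : ∀ l, l ≤ i + 1 → ∀ a, 1 ≤ a → a < l → √R ≤ P'.S a ∧ P'.S a ≤ 1 := by
    intro l hl a h1 ha
    rw [(hagree a (by omega)).1]
    exact ⟨(hbig a h1 (by omega)).le, by linarith [h.le_half h1 (show a ≤ i by omega)]⟩
  refine ⟨P', ⟨by omega, ?_, ?_, ?_, ?_, ?_, ?_⟩, hagree⟩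
  · rw [(hagree 1 hone).1, h.start_eq]
  · rw [(hagree 1 hone).1]; exact h.start_lt
  · rw [(hagree 1 hone).2.1, h.m_one]
  · rw [(hagree 1 hone).1, (hagree 1 hone).2.2, h.T_one_zero]
  · rw [(hagree 1 hone).2.2, h.T_one_one]
  · intro l h2 hl
    rw [(hagree (l - 1) (by omega)).1]
    rcases eq_or_lt_of_le hl with rfl | hl'
    · refine ⟨by simpa using hi, ?_, ?_, ?_, ?_, ?_⟩
      · rw [hS', Nat.add_sub_cancel, (hagree i le_rfl).1]; exact hs
      · rw [hm']; exact hm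
      · rw [hm']; simpa using hmi
      · rw [hS', hm', hT', validThresholds_iff_feasible hm (by simpa using hmi) (hbounds _ le_rfl)]
        exact hto _ le_rfl _ _ _ (by simpa using hmi) hf
      · intro s' m' T' h1 h2 h3 h4
        rw [Nat.add_sub_cancel, (hagree i le_rfl).1] at h1
        rw [validThresholds_iff_feasible h2 h3 (hbounds _ le_rfl)] at h4
        rw [hS']
        exact hmin s' m' T' h1 h2 (by simpa using h3) (hfrom _ le_rfl _ _ _ h3 h4)
    · have hl' : l ≤ i := by omega
      obtain ⟨hgt, hst⟩ := h.step l h2 hl'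
      obtain ⟨e1, e2, e3⟩ := hagree l hl'
      refine ⟨hgt, ?_, ?_, ?_, ?_, ?_⟩
      · rw [e1, (hagree (l - 1) (by omega)).1]; exact hst.lt
      · rw [e2]; exact hst.one_le
      · rw [e2]; exact hst.le
      · rw [e1, e2, e3, validThresholds_iff_feasible hst.one_le hst.le (hbounds _ hl)]
        exact hto _ hl _ _ _ hst.le (h.feasible h2 hl')
      · intro s' m' T' h1 h3 h4 h5
        rw [(hagree (l - 1) (by omega)).1] at h1
        rw [validThresholds_iff_feasible h3 h4 (hbounds _ hl)] at h5
        rw [e1]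
        exact h.le_of_feasible h2 hl' h1 h3 h4 (hfrom _ hl _ _ _ h4 h5)

theorem exists_isRun_one (R : ℝ) (κ : Kind) (h : κ = Kind.even → start R κ < 1 / 2) :
    ∃ P, IsRun R κ 1 P := by
  refine ⟨⟨fun _ => start R κ, fun _ => 1, fun _ j => if j = 0 then start R κ + √R else 1⟩,
    le_rfl, rfl, h, rfl, by simp, by simp, fun l h2 h1 => by omega⟩

/-- If the lengths of the runs are bounded, some run stops. -/
theorem exists_isCompleteRun (hR : 0 < R) (h6 : 1 / 6 < √R)
    (h : κ = Kind.even → start R κ < 1 / 2) {N : ℕ} (hN : ∀ i P, IsRun R κ i P → i ≤ N) :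
    ∃ n P, IsCompleteRun R κ n P := by
  by_contra! hcon
  have hall : ∀ i, ∃ P, IsRun R κ (i + 1) P := by
    intro i
    induction i with
    | zero => exact exists_isRun_one R κ h
    | succ i ih =>
      obtain ⟨P, hP⟩ := ih
      have hlt : √R < P.S (i + 1) := not_le.1 fun hle => hcon _ _ ⟨hP, hle⟩
      obtain ⟨P', hP', _⟩ := hP.exists_succ hR h6 hlt
      exact ⟨P', hP'⟩
  obtain ⟨P, hP⟩ := hall N
  have := hN _ _ hP
  omega

/-- The values `P 1, …, P a` of a lower half, numbered downwards, in which every state is reached by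
feasible circles and the last state is the first one whose value is at most `√R`. -/
structure IsChain (R : ℝ) (P : ℕ → ℝ) (a : ℕ) : Prop where
  one_le : 1 ≤ a
  sqrt_lt : ∀ l, 1 ≤ l → l < a → √R < P l
  last_le : P a ≤ √R
  feasible : ∀ l, 2 ≤ l → l ≤ a → ∃ m T, 1 ≤ m ∧ m ≤ l - 1 ∧ Feasible R P l (P l) m T

/-- The algorithm is greedy: its states lie below those of every chain that starts higher. -/
theorem IsRun.le_chain (hR : 0 < R) (h : IsRun R κ i P) {Q : ℕ → ℝ} {a : ℕ} (hQ : IsChain R Q a)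
    (hstart : start R κ ≤ Q 1) : ∀ l, 1 ≤ l → l ≤ i → l ≤ a ∧ P.S l ≤ Q l := by
  intro l
  induction l using Nat.strong_induction_on with
  | _ l ih =>
    intro h1 hl
    rcases eq_or_lt_of_le h1 with rfl | h2
    · exact ⟨hQ.one_le, by rw [h.start_eq]; exact hstart⟩
    · obtain ⟨ha, hle⟩ := ih (l - 1) (by omega) (by omega) (by omega)
      have hgt := h.sqrt_lt (l := l - 1) (by omega) (by omega)
      have hla : l ≤ a := by
        by_contra! hcon
        have : l - 1 = a := by omega
        rw [this] at hle hgt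
        linarith [hQ.last_le]
      refine ⟨hla, ?_⟩
      by_cases hcase : Q l < P.S (l - 1)
      · obtain ⟨m, T, hm, hml, hf⟩ := hQ.feasible l h2 hla
        refine h.le_of_feasible h2 hl hcase hm hml (hf.of_le hR hml fun b hb hbl => ?_)
        exact ⟨(h.sqrt_lt hb (by omega)).le, (ih b hbl hb (by omega)).2⟩
      · have := (h.step l h2 hl).2.lt
        linarith

theorem IsRun.length_le (hR : 0 < R) (h : IsRun R κ i P) {Q : ℕ → ℝ} {a : ℕ} (hQ : IsChain R Q a)
    (hstart : start R κ ≤ Q 1) : i ≤ a :=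
  (h.le_chain hR hQ hstart i h.one_le le_rfl).1

end Run

/-- Samples `1` and `1/2 - √R` on the circle through the two highest states of a lower half force
`√R > 1/6`. -/
theorem IsChain.one_sixth_lt {R : ℝ} (hR : 0 < R) (hR2 : √R < 1 / 2) {Q : ℕ → ℝ} {a : ℕ}
    (hQ : IsChain R Q a) (h1 : 1 / 2 ≤ Q 1) (h2 : 2 ≤ a → Q 2 < 1 / 2) : 1 / 6 < √R := by
  have hr0 := Real.sqrt_pos.2 hR
  have hs := Real.sq_sqrt hR.le
  have ha : 2 ≤ a := by
    by_contra! hcon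
    have := hQ.one_le
    have h3 : a = 1 := by omega
    have := hQ.last_le
    rw [h3] at this
    linarith
  have h2 := h2 ha
  obtain ⟨m, T, hm, hm', hf⟩ := hQ.feasible 2 le_rfl ha
  have hm1 : m = 1 := by omega
  subst hm1
  -- `c` is the mean of the samples `1` and `1/2 - √R`
  have hc := (hf.circle 0 one_pos ((3 / 2 - √R) / 2) (by linarith) (by linarith)).2
  have ht := hf.top
  rw [zero_add, ht, circleExcess_succ, circleExcess_zero] at hc
  have hmono := downExcess_mono (c := (3 / 2 - √R) / 2) hR (by linarith) hR2.le h1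
  rw [downExcess_of_ge hR.le hR2.le (by linarith)] at hmono
  simp only [Nat.sub_zero, Nat.add_one_sub_one] at hc
  unfold excess at hc
  nlinarith

/-! ### Regret and potentials -/

namespace FSM

variable {k : ℕ}

/-- The sample `X` can take the machine from state `i` to state `l`, up to the ambiguity at the
thresholds: the sample intervals are closed on both sides. This makes the relation symmetric under
mirroring. -/
def Edge (M : FSM k) (i l : Fin k) (X : ℝ) : Prop :=
  ∃ j : ℤ, -(M.down i : ℤ) ≤ j ∧ j ≤ M.up i ∧ ((l : ℕ) : ℤ) = (i : ℕ) + j ∧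
    M.thr i (j - 1) ≤ X ∧ X ≤ M.thr i j

theorem thr_mem_Icc (M : FSM k) (i : Fin k) {j : ℤ} (h1 : -(M.down i : ℤ) - 1 ≤ j)
    (h2 : j ≤ M.up i) : 0 ≤ M.thr i j ∧ M.thr i j ≤ 1 := by
  have hm := (M.thr_strictMono i).monotoneOn
  refine ⟨?_, ?_⟩
  · rw [← M.thr_bot i]
    exact hm ⟨le_rfl, by omega⟩ ⟨h1, h2⟩ h1
  · rw [← M.thr_top i]
    exact hm ⟨h1, h2⟩ ⟨by omega, le_rfl⟩ h2

theorem thr_lt (M : FSM k) (i : Fin k) {a b : ℤ} (h1 : -(M.down i : ℤ) - 1 ≤ a) (hab : a < b)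
    (h2 : b ≤ M.up i) : M.thr i a < M.thr i b :=
  M.thr_strictMono i ⟨h1, by omega⟩ ⟨by omega, h2⟩ hab

theorem edge_next (M : FSM k) (i : Fin k) {x : ℝ} (h0 : 0 ≤ x) (h1 : x ≤ 1) :
    M.Edge i (M.next i x) x := by
  classical
  have hne : ((Finset.Icc (-(M.down i : ℤ)) (M.up i)).filter
      fun j => x < M.thr i j ∨ j = M.up i).Nonempty :=
    ⟨M.up i, by simp⟩
  set j := Finset.min' _ hne with hj
  have hmem := Finset.min'_mem _ hne
  rw [← hj, Finset.mem_filter, Finset.mem_Icc] at hmem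
  obtain ⟨⟨ha, hb⟩, hc⟩ := hmem
  have hlow : M.thr i (j - 1) ≤ x := by
    rcases eq_or_lt_of_le ha with h | h
    · rw [← h, M.thr_bot]; exact h0
    · by_contra! hcon
      have := Finset.min'_le _ (j - 1) (by
        rw [Finset.mem_filter, Finset.mem_Icc]
        exact ⟨⟨by omega, by omega⟩, Or.inl hcon⟩ :
          j - 1 ∈ (Finset.Icc (-(M.down i : ℤ)) (M.up i)).filter
            fun j => x < M.thr i j ∨ j = M.up i)
      omega
  refine ⟨j, ha, hb, M.next_eq i x j ha hb hlow hc, hlow, ?_⟩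
  rcases hc with hc | hc
  · exact hc.le
  · rw [hc, M.thr_top]; exact h1

theorem state_congr (M : FSM k) (s₀ : Fin k) {x y : ℕ → Set.Icc (0 : ℝ) 1} {n : ℕ}
    (h : ∀ t < n, x t = y t) : M.state s₀ x n = M.state s₀ y n := by
  induction n with
  | zero => rfl
  | succ n ih =>
    simp only [state]
    rw [ih fun t ht => h t (by omega), h n (by omega)]

/-- The mean minimizes the mean square error. -/
theorem sum_sub_mean_sq_le (x : ℕ → ℝ) {n : ℕ} (hn : 0 < n) (c : ℝ) :
    ∑ t ∈ Finset.range n, (x t - (1 / (n : ℝ)) * ∑ u ∈ Finset.range n, x u) ^ 2 ≤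
      ∑ t ∈ Finset.range n, (x t - c) ^ 2 := by
  have hn0 : (n : ℝ) ≠ 0 := by positivity
  set μ := (1 / (n : ℝ)) * ∑ u ∈ Finset.range n, x u with hμ
  have hsum : ∑ t ∈ Finset.range n, x t = n * μ := by rw [hμ]; field_simp
  have : ∑ t ∈ Finset.range n, (x t - c) ^ 2 =
      ∑ t ∈ Finset.range n, (x t - μ) ^ 2 + n * (μ - c) ^ 2 := by
    have e : ∀ t ∈ Finset.range n, (x t - c) ^ 2 =
        (x t - μ) ^ 2 + (2 * (μ - c) * x t + (c ^ 2 - μ ^ 2)) := fun t _ => by ring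
    rw [Finset.sum_congr rfl e, Finset.sum_add_distrib, Finset.sum_add_distrib, ← Finset.mul_sum,
      hsum, Finset.sum_const, Finset.card_range, nsmul_eq_mul]
    ring
  rw [this]
  have : 0 ≤ (n : ℝ) * (μ - c) ^ 2 := by positivity
  linarith

theorem sum_excess (M : FSM k) (s₀ : Fin k) (R c : ℝ) (x : ℕ → Set.Icc (0 : ℝ) 1) (n : ℕ) :
    ∑ t ∈ Finset.range n, excess R c (M.value (M.state s₀ x t)) (x t) =
      ∑ t ∈ Finset.range n, ((x t : ℝ) - M.value (M.state s₀ x t)) ^ 2 -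
        ∑ t ∈ Finset.range n, ((x t : ℝ) - c) ^ 2 - n * R := by
  unfold excess
  rw [Finset.sum_sub_distrib, Finset.sum_sub_distrib, Finset.sum_const, Finset.card_range,
    nsmul_eq_mul]

theorem regret_eq (M : FSM k) (s₀ : Fin k) (R : ℝ) (x : ℕ → Set.Icc (0 : ℝ) 1) {n : ℕ}
    (hn : 0 < n) : M.regret s₀ x n = R + (1 / (n : ℝ)) * ∑ t ∈ Finset.range n,
      excess R ((1 / (n : ℝ)) * ∑ u ∈ Finset.range n, (x u : ℝ))
        (M.value (M.state s₀ x t)) (x t) := by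
  have hn0 : (n : ℝ) ≠ 0 := by positivity
  rw [sum_excess]
  unfold regret
  field_simp
  ring

theorem exists_value_bound (M : FSM k) : ∃ V, 0 ≤ V ∧ ∀ i, ∀ x : ℝ, 0 ≤ x → x ≤ 1 →
    (x - M.value i) ^ 2 ≤ V := by
  refine ⟨∑ i, (1 + |M.value i|) ^ 2, Finset.sum_nonneg fun i _ => sq_nonneg _,
    fun i x h0 h1 => ?_⟩
  have h2 : (x - M.value i) ^ 2 ≤ (1 + |M.value i|) ^ 2 := by
    apply sq_le_sq'
    · linarith [neg_abs_le (M.value i), le_abs_self (M.value i)]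
    · linarith [neg_abs_le (M.value i), le_abs_self (M.value i)]
  exact h2.trans (Finset.single_le_sum (f := fun i => (1 + |M.value i|) ^ 2)
    (fun i _ => sq_nonneg _) (Finset.mem_univ i))

theorem regret_le_bound (M : FSM k) (s₀ : Fin k) {V : ℝ} (hV0 : 0 ≤ V)
    (hV : ∀ i, ∀ x : ℝ, 0 ≤ x → x ≤ 1 → (x - M.value i) ^ 2 ≤ V) (x : ℕ → Set.Icc (0 : ℝ) 1)
    (n : ℕ) : M.regret s₀ x n ≤ V := by
  rcases Nat.eq_zero_or_pos n with rfl | hn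
  · simpa [regret] using hV0
  have hn0 : (0 : ℝ) < n := by positivity
  have h1 : ∑ t ∈ Finset.range n, ((x t : ℝ) - M.value (M.state s₀ x t)) ^ 2 ≤ n * V := by
    have := Finset.sum_le_card_nsmul (Finset.range n) _ V
      fun t _ => hV (M.state s₀ x t) (x t) (x t).2.1 (x t).2.2
    rwa [Finset.card_range, nsmul_eq_mul] at this
  have h2 : 0 ≤ (1 / (n : ℝ)) * ∑ t ∈ Finset.range n,
      ((x t : ℝ) - (1 / (n : ℝ)) * ∑ u ∈ Finset.range n, (x u : ℝ)) ^ 2 :=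
    mul_nonneg (by positivity) (Finset.sum_nonneg fun t _ => sq_nonneg _)
  have h3 : (1 / (n : ℝ)) * ∑ t ∈ Finset.range n,
      ((x t : ℝ) - M.value (M.state s₀ x t)) ^ 2 ≤ V := by
    rw [one_div, inv_mul_le_iff₀ hn0]
    exact h1
  unfold regret
  linarith

theorem bddAbove_regret (M : FSM k) (s₀ : Fin k) (n : ℕ) :
    BddAbove (Set.range fun x : ℕ → Set.Icc (0 : ℝ) 1 => M.regret s₀ x n) := by
  obtain ⟨V, hV0, hV⟩ := M.exists_value_bound
  exact ⟨V, by rintro _ ⟨x, rfl⟩; exact M.regret_le_bound s₀ hV0 hV x n⟩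

theorem iSup_regret_nonneg (M : FSM k) (s₀ : Fin k) (n : ℕ) :
    0 ≤ ⨆ x : ℕ → Set.Icc (0 : ℝ) 1, M.regret s₀ x n := by
  refine le_trans ?_ (le_ciSup (M.bddAbove_regret s₀ n) fun _ => ⟨0, by simp⟩)
  simp only [regret, Finset.sum_const_zero, mul_zero, sub_self, ne_eq, OfNat.ofNat_ne_zero,
    not_false_eq_true, zero_pow, sub_zero]
  exact mul_nonneg (by positivity) (Finset.sum_nonneg fun t _ => sq_nonneg _)

/-- A potential whose increments dominate the excess loss bounds the maximal regret: the excess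
loss telescopes along every path. -/
theorem maxRegret_le_of_potential (M : FSM k) {R : ℝ} (φ : ℝ → Fin k → ℝ)
    (hφ : ∀ i, Continuous fun c => φ c i)
    (h : ∀ c, 0 ≤ c → c ≤ 1 → ∀ i l X, M.Edge i l X →
      excess R c (M.value i) X ≤ φ c l - φ c i) (s₀ : Fin k) : M.maxRegret s₀ ≤ R := by
  obtain ⟨B, hB⟩ : ∃ B, ∀ c, 0 ≤ c → c ≤ 1 → ∀ i, |φ c i| ≤ B := by
    choose b hb using fun i => (isCompact_Icc (a := (0 : ℝ)) (b := 1)).exists_bound_of_continuousOn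
      (hφ i).continuousOn
    refine ⟨∑ i, |b i|, fun c h0 h1 i => ((hb i c ⟨h0, h1⟩).trans (le_abs_self _)).trans ?_⟩
    exact Finset.single_le_sum (f := fun i => |b i|) (fun i _ => abs_nonneg _) (Finset.mem_univ i)
  have hreg : ∀ n : ℕ, 0 < n → ∀ x, M.regret s₀ x n ≤ R + 2 * B / n := by
    intro n hn x
    have hn0 : (0 : ℝ) < n := by positivity
    rw [M.regret_eq s₀ R x hn]
    set c := (1 / (n : ℝ)) * ∑ u ∈ Finset.range n, (x u : ℝ) with hc
    have hc0 : 0 ≤ c := mul_nonneg (by positivity) (Finset.sum_nonneg fun u _ => (x u).2.1)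
    have hc1 : c ≤ 1 := by
      rw [hc, one_div, inv_mul_le_iff₀ hn0]
      have := Finset.sum_le_card_nsmul (Finset.range n) (fun u => (x u : ℝ)) 1
        fun u _ => (x u).2.2
      rwa [Finset.card_range, nsmul_eq_mul] at this
    have hsum : ∑ t ∈ Finset.range n, excess R c (M.value (M.state s₀ x t)) (x t) ≤
        φ c (M.state s₀ x n) - φ c (M.state s₀ x 0) := by
      rw [← Finset.sum_range_sub (fun t => φ c (M.state s₀ x t))]
      exact Finset.sum_le_sum fun t _ =>
        h c hc0 hc1 _ _ _ (M.edge_next (M.state s₀ x t) (x t).2.1 (x t).2.2)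
    have h1 := (abs_le.1 (hB c hc0 hc1 (M.state s₀ x n))).2
    have h2 := (abs_le.1 (hB c hc0 hc1 (M.state s₀ x 0))).1
    have h3 : (1 / (n : ℝ)) * ∑ t ∈ Finset.range n,
        excess R c (M.value (M.state s₀ x t)) (x t) ≤ 2 * B / n := by
      rw [one_div, inv_mul_eq_div]
      exact div_le_div_of_nonneg_right (by linarith) hn0.le
    linarith
  have hlim : Tendsto (fun n : ℕ => R + 2 * B / (n : ℝ)) atTop (𝓝 R) := by
    simpa using (tendsto_const_nhds (x := R)).add (tendsto_const_div_atTop_nhds_zero_nat (2 * B))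
  rw [maxRegret, ← hlim.limsup_eq]
  refine limsup_le_limsup ?_ ?_ hlim.isBoundedUnder_le
  · filter_upwards [eventually_gt_atTop 0] with n hn
    exact ciSup_le (hreg n hn)
  · exact isCoboundedUnder_le_of_le atTop (x := 0) fun n => M.iSup_regret_nonneg s₀ n

/-- A set `A` of states that cannot be left and on which the excess losses are increments of a
potential, up to arbitrarily small errors. -/
structure Controlled (M : FSM k) (R : ℝ) (A : Set (Fin k)) : Prop where
  nonempty : A.Nonempty
  closed : ∀ i l X, i ∈ A → M.Edge i l X → l ∈ A
  potential : ∀ δ : ℝ, 0 < δ → ∀ c : ℝ, ∃ φ : Fin k → ℝ, ∀ i l X, i ∈ A → M.Edge i l X →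
    excess R c (M.value i) X ≤ φ l - φ i + δ

/-- Small maximal regret gives approximate potentials on the reachable states: the supremum of the
excess loss, diminished by `δ` per step, over all paths to a state. -/
theorem exists_controlled (M : FSM k) {R : ℝ} (hR : 0 ≤ R) {s₀ : Fin k}
    (h : M.maxRegret s₀ ≤ R) : ∃ A, M.Controlled R A := by
  have hedge : ∀ (i l : Fin k) (j : ℤ) (X : ℝ), -(M.down i : ℤ) ≤ j → j ≤ M.up i →
      ((l : ℕ) : ℤ) = (i : ℕ) + j → M.thr i (j - 1) ≤ X → X < M.thr i j →
      ∃ y : Set.Icc (0 : ℝ) 1, (y : ℝ) = X ∧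
        M.next i y = l := by
    intro i l j X h1 h2 h3 h4 h5
    refine ⟨⟨X, (M.thr_mem_Icc i (by omega) (by omega)).1.trans h4,
      h5.le.trans (M.thr_mem_Icc i (by omega) h2).2⟩, rfl, ?_⟩
    have := M.next_eq i X j h1 h2 h4 (Or.inl h5)
    apply Fin.ext
    have h6 : ((M.next i X : ℕ) : ℤ) = (l : ℕ) := by rw [this, h3]
    exact_mod_cast h6
  -- the reachable states
  let A : Set (Fin k) := {i | ∃ x n, M.state s₀ x n = i}
  have hupd : ∀ (x : ℕ → Set.Icc (0 : ℝ) 1) n y, ∀ t ≤ n,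
      M.state s₀ (Function.update x n y) t = M.state s₀ x t := fun x n y t ht =>
    M.state_congr s₀ fun u hu => Function.update_of_ne (by omega) _ _
  refine ⟨A, ⟨s₀, fun _ => ⟨0, by simp⟩, 0, rfl⟩, ?_, ?_⟩
  · rintro i l X ⟨x, n, rfl⟩ ⟨j, h1, h2, h3, h4, h5⟩
    obtain ⟨y, _, hy⟩ := hedge _ l j _ h1 h2 h3 le_rfl (M.thr_lt _ (by omega) (by omega) h2)
    refine ⟨Function.update x n y, n + 1, ?_⟩
    simp only [state]
    rw [hupd x n y n le_rfl, Function.update_self]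
    exact hy
  · intro δ hδ c
    obtain ⟨V, hV0, hV⟩ := M.exists_value_bound
    have hev : ∀ᶠ n in atTop, (⨆ x : ℕ → Set.Icc (0 : ℝ) 1, M.regret s₀ x n) < R + δ := by
      refine eventually_lt_of_limsup_lt (lt_of_le_of_lt h (by linarith)) ?_
      exact isBoundedUnder_of ⟨V, fun n => ciSup_le fun x => M.regret_le_bound s₀ hV0 hV x n⟩
    obtain ⟨N, hN⟩ := eventually_atTop.1 hev
    let D : (ℕ → Set.Icc (0 : ℝ) 1) → ℕ → ℝ := fun x n =>
      ∑ t ∈ Finset.range n, (excess R c (M.value (M.state s₀ x t)) (x t) - δ)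
    -- Long paths have regret at most `R + δ`, short ones are bounded trivially.
    have hD : ∀ x n, D x n ≤ (N + 1) * V := by
      intro x n
      have hsum : D x n = ∑ t ∈ Finset.range n, ((x t : ℝ) - M.value (M.state s₀ x t)) ^ 2 -
        ∑ t ∈ Finset.range n, ((x t : ℝ) - c) ^ 2 - n * R - n * δ := by
        simp only [D]
        rw [Finset.sum_sub_distrib, M.sum_excess, Finset.sum_const, Finset.card_range,
          nsmul_eq_mul]
      rcases lt_or_ge n (N + 1) with hn | hn
      · have h1 : ∑ t ∈ Finset.range n, ((x t : ℝ) - M.value (M.state s₀ x t)) ^ 2 ≤ n * V := by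
          have := Finset.sum_le_card_nsmul (Finset.range n) _ V
            fun t _ => hV (M.state s₀ x t) (x t) (x t).2.1 (x t).2.2
          rwa [Finset.card_range, nsmul_eq_mul] at this
        have h2 : 0 ≤ ∑ t ∈ Finset.range n, ((x t : ℝ) - c) ^ 2 :=
          Finset.sum_nonneg fun t _ => sq_nonneg _
        have h3 : (n : ℝ) * V ≤ (N + 1) * V := by
          have : (n : ℝ) ≤ N + 1 := by exact_mod_cast hn.le
          exact mul_le_mul_of_nonneg_right this hV0
        have h4 : 0 ≤ (n : ℝ) * R := by positivity
        have h5 : 0 ≤ (n : ℝ) * δ := by positivity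
        linarith
      · have hn0 : (0 : ℝ) < n := by
          have : 0 < n := by omega
          exact_mod_cast this
        have h1 : M.regret s₀ x n ≤ R + δ :=
          (le_ciSup (M.bddAbove_regret s₀ n) x).trans (hN n (by omega)).le
        have h2 := sum_sub_mean_sq_le (fun t => (x t : ℝ)) (n := n) (by omega) c
        have h3 : ∑ t ∈ Finset.range n, ((x t : ℝ) - M.value (M.state s₀ x t)) ^ 2 -
            ∑ t ∈ Finset.range n,
              ((x t : ℝ) - (1 / (n : ℝ)) * ∑ u ∈ Finset.range n, (x u : ℝ)) ^ 2 ≤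
            n * (R + δ) := by
          unfold regret at h1
          rwa [← mul_sub, one_div, inv_mul_le_iff₀ hn0, ← one_div] at h1
        have h4 : 0 ≤ ((N : ℝ) + 1) * V := by positivity
        linarith
    let φ : Fin k → ℝ := fun i => sSup {d | ∃ x n, M.state s₀ x n = i ∧ d = D x n}
    have hbdd : ∀ i, BddAbove {d | ∃ x n, M.state s₀ x n = i ∧ d = D x n} := fun i =>
      ⟨(N + 1) * V, by rintro _ ⟨x, n, _, rfl⟩; exact hD x n⟩
    have hstep : ∀ i ∈ A, ∀ y : Set.Icc (0 : ℝ) 1,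
        excess R c (M.value i) y ≤ φ (M.next i y) - φ i + δ := by
      rintro i ⟨x₀, n₀, hx₀⟩ y
      have : φ i ≤ φ (M.next i y) + δ - excess R c (M.value i) y := by
        refine csSup_le ⟨_, x₀, n₀, hx₀, rfl⟩ ?_
        rintro _ ⟨x, n, rfl, rfl⟩
        have hmem : D x n + (excess R c (M.value (M.state s₀ x n)) y - δ) ≤
            φ (M.next (M.state s₀ x n) y) := by
          refine le_csSup (hbdd _) ⟨Function.update x n y, n + 1, ?_, ?_⟩
          · simp only [state]
            rw [hupd x n y n le_rfl, Function.update_self]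
          · simp only [D]
            rw [Finset.sum_range_succ, hupd x n y n le_rfl, Function.update_self]
            congr 1
            refine Finset.sum_congr rfl fun t ht => ?_
            have ht := Finset.mem_range.1 ht
            rw [hupd x n y t ht.le, Function.update_of_ne (by omega)]
        linarith
      linarith
    refine ⟨φ, ?_⟩
    rintro i l X hi ⟨j, h1, h2, h3, h4, h5⟩
    have hlt := M.thr_lt i (a := j - 1) (b := j) (by omega) (by omega) h2
    -- The sample intervals of the machine are half open; the closed ones follow by continuity.
    have hcl : IsClosed {X | excess R c (M.value i) X ≤ φ l - φ i + δ} := by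
      unfold excess
      exact isClosed_le (by fun_prop) continuous_const
    have hsub : Set.Ico (M.thr i (j - 1)) (M.thr i j) ⊆
        {X | excess R c (M.value i) X ≤ φ l - φ i + δ} := by
      intro Y hY
      obtain ⟨y, hy1, hy2⟩ := hedge i l j Y h1 h2 h3 hY.1 hY.2
      have := hstep i hi y
      rwa [hy2, hy1] at this
    have := closure_minimal hsub hcl
    rw [closure_Ico hlt.ne] at this
    exact this ⟨h4, h5⟩

/-- The image of a machine under `x ↦ 1 - x`. -/
def mirror (M : FSM k) : FSM k where
  value i := 1 - M.value i.rev
  down i := M.up i.rev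
  up i := M.down i.rev
  thr i j := 1 - M.thr i.rev (-j - 1)
  down_le i := by
    have := M.up_lt i.rev
    have := Fin.val_rev i
    omega
  up_lt i := by
    have := M.down_le i.rev
    have := Fin.val_rev i
    omega
  thr_bot i := by
    rw [show -(-(M.up i.rev : ℤ) - 1) - 1 = M.up i.rev by ring, M.thr_top]; ring
  thr_top i := by rw [M.thr_bot]; ring
  thr_strictMono i := by
    intro a ha b hb hab
    simp only [Set.mem_Icc] at ha hb
    have := M.thr_lt i.rev (a := -b - 1) (b := -a - 1) (by omega) (by omega) (by omega)
    linarith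

theorem Edge.of_mirror {M : FSM k} {i l : Fin k} {X : ℝ} (h : M.mirror.Edge i l X) :
    M.Edge i.rev l.rev (1 - X) := by
  obtain ⟨j, h1, h2, h3, h4, h5⟩ := h
  simp only [mirror] at h1 h2 h4 h5
  refine ⟨-j, by omega, by omega, ?_, by linarith, ?_⟩
  · have := Fin.val_rev i
    have := Fin.val_rev l
    omega
  · rw [show -(j - 1) - 1 = -j by ring] at h4
    linarith

theorem IsDTM.mirror {M : FSM k} (h : M.IsDTM) : M.mirror.IsDTM where
  strictMono i l hil := by
    have := h.strictMono (Fin.rev_lt_rev.2 hil)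
    show 1 - M.value i.rev < 1 - M.value l.rev
    linarith
  down_le_one i hi := h.up_le_one i.rev (by
    have : 1 - M.value i.rev ≤ 1 / 2 := hi
    linarith)
  up_le_one i hi := h.down_le_one i.rev (by
    have : 1 / 2 ≤ 1 - M.value i.rev := hi
    linarith)
  leave_lower i l hi hl hil := by
    have hi : 1 - M.value i.rev ≤ 1 / 2 := hi
    have hl : 1 / 2 < 1 - M.value l.rev := hl
    have hil : (l : ℕ) ≤ i + M.down i.rev := hil
    have h1 := Fin.val_rev i
    have h2 := Fin.val_rev l
    have := h.leave_upper i.rev l.rev (by linarith) (by linarith) (by omega)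
    omega
  leave_upper i l hi hl hil := by
    have hi : 1 / 2 ≤ 1 - M.value i.rev := hi
    have hl : 1 - M.value l.rev < 1 / 2 := hl
    have hil : (i : ℕ) ≤ l + M.up i.rev := hil
    have h1 := Fin.val_rev i
    have h2 := Fin.val_rev l
    have := h.leave_lower i.rev l.rev (by linarith) (by linarith) (by omega)
    omega

theorem Controlled.mirror {M : FSM k} {R : ℝ} {A : Set (Fin k)} (h : M.Controlled R A) :
    M.mirror.Controlled R {i | i.rev ∈ A} where
  nonempty := by
    obtain ⟨i, hi⟩ := h.nonempty
    exact ⟨i.rev, by simpa using hi⟩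
  closed i l X hi hil := h.closed _ _ _ hi hil.of_mirror
  potential δ hδ c := by
    obtain ⟨φ, hφ⟩ := h.potential δ hδ (1 - c)
    refine ⟨fun i => φ i.rev, fun i l X hi hil => ?_⟩
    have := hφ _ _ _ hi hil.of_mirror
    rwa [← excess_mirror, sub_sub_cancel, sub_sub_cancel] at this

end FSM

/-! ### Lower and upper halves of an arbitrary machine -/

namespace FSM

variable {k : ℕ} {M : FSM k} {R : ℝ} {A : Set (Fin k)}

theorem Controlled.self_loop (h : M.Controlled R A) {i : Fin k} (hi : i ∈ A) :
    M.value i - √R ≤ M.thr i (-1) ∧ M.thr i 0 ≤ M.value i + √R := by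
  have key : ∀ X, M.Edge i i X → (X - M.value i) ^ 2 ≤ R := by
    intro X hX
    refine le_of_forall_pos_le_add fun δ hδ => ?_
    obtain ⟨φ, hφ⟩ := h.potential δ hδ X
    have := hφ i i X hi hX
    unfold excess at this
    linarith
  have hlt := M.thr_lt i (a := -1) (b := 0) (by omega) (by omega) (by omega)
  have h1 := Real.abs_le_sqrt (key (M.thr i (-1)) ⟨0, by omega, by omega, by omega, le_rfl, hlt.le⟩)
  have h2 := Real.abs_le_sqrt (key (M.thr i 0) ⟨0, by omega, by omega, by omega, hlt.le, le_rfl⟩)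
  exact ⟨by linarith [(abs_le.1 h1).1], by linarith [(abs_le.1 h2).2]⟩

theorem Controlled.up_pos (h : M.Controlled R A) {i : Fin k} (hi : i ∈ A)
    (hv : M.value i + √R < 1) : 1 ≤ M.up i := by
  by_contra! hcon
  have h0 : M.up i = 0 := by omega
  have h1 := M.thr_top i
  rw [h0] at h1
  have := (h.self_loop hi).2
  simp only [Nat.cast_zero] at h1
  linarith

theorem Controlled.down_pos (h : M.Controlled R A) {i : Fin k} (hi : i ∈ A)
    (hv : √R < M.value i) : 1 ≤ M.down i := by
  by_contra! hcon
  have h0 : M.down i = 0 := by omega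
  have h1 := M.thr_bot i
  rw [h0] at h1
  have := (h.self_loop hi).1
  simp only [Nat.cast_zero, neg_zero, zero_sub] at h1
  linarith

theorem edge_bot (M : FSM k) {i l : Fin k} (j : ℤ) (h1 : -(M.down i : ℤ) ≤ j) (h2 : j ≤ M.up i)
    (h3 : ((l : ℕ) : ℤ) = (i : ℕ) + j) : M.Edge i l (M.thr i (j - 1)) :=
  ⟨j, h1, h2, h3, le_rfl, (M.thr_lt i (by omega) (by omega) h2).le⟩

theorem edge_top (M : FSM k) {i l : Fin k} (j : ℤ) (h1 : -(M.down i : ℤ) ≤ j) (h2 : j ≤ M.up i)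
    (h3 : ((l : ℕ) : ℤ) = (i : ℕ) + j) : M.Edge i l (M.thr i j) :=
  ⟨j, h1, h2, h3, (M.thr_lt i (by omega) (by omega) h2).le, le_rfl⟩

theorem Controlled.pred_mem (h : M.Controlled R A) {i l : Fin k} (hi : i ∈ A)
    (hv : √R < M.value i) (hl : (l : ℕ) + 1 = i) : l ∈ A :=
  h.closed i l _ hi (M.edge_bot (-1) (by have := h.down_pos hi hv; omega) (by omega) (by omega))

theorem Controlled.succ_mem (h : M.Controlled R A) {i l : Fin k} (hi : i ∈ A)
    (hv : M.value i + √R < 1) (hl : (l : ℕ) = i + 1) : l ∈ A :=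
  h.closed i l _ hi (M.edge_bot 1 (by omega) (by have := h.up_pos hi hv; omega) (by omega))

/-- Down steps of one state from a state above `√R` can be made on the samples `0` and `v - √R`. -/
theorem Controlled.downExcess_le (h : M.Controlled R A) {i l : Fin k} (hi : i ∈ A)
    (hv : √R < M.value i) (hd : M.down i ≤ 1) (hl : (l : ℕ) + 1 = i) {c δ : ℝ} {φ : Fin k → ℝ}
    (hφ : ∀ i l X, i ∈ A → M.Edge i l X → excess R c (M.value i) X ≤ φ l - φ i + δ) :
    downExcess R c (M.value i) ≤ φ l - φ i + δ := by
  have hd1 : M.down i = 1 := le_antisymm hd (h.down_pos hi hv)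
  have h0 : M.thr i (-1 - 1) = 0 := by
    have := M.thr_bot i
    rwa [hd1] at this
  have h1 := (h.self_loop hi).1
  have hedge : ∀ X, 0 ≤ X → X ≤ M.value i - √R → M.Edge i l X := fun X hX0 hX1 =>
    ⟨-1, by omega, by omega, by omega, h0.trans_le hX0, hX1.trans h1⟩
  exact max_le (hφ i l _ hi (hedge 0 le_rfl (by linarith)))
    (hφ i l _ hi (hedge _ (by linarith) le_rfl))

/-- The values as a function on `ℕ`, extended by `0`. -/
noncomputable def val (M : FSM k) (n : ℕ) : ℝ := if h : n < k then M.value ⟨n, h⟩ else 0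

theorem val_of_lt (M : FSM k) {n : ℕ} (h : n < k) : M.val n = M.value ⟨n, h⟩ := dif_pos h

/-- The states from `b` downwards form a chain if they go down by single steps and do not jump
beyond `b`. -/
theorem Controlled.exists_isChain (h : M.Controlled R A) (hR2 : √R < 1 / 2) {b : Fin k} (hb : b ∈ A)
    (hhalf : ∀ q < b, M.value q ≤ 1 / 2)
    (hup : ∀ q < b, (q : ℕ) + M.up q ≤ b) (hdown : ∀ q ≤ b, M.down q ≤ 1) :
    ∃ a, IsChain R (fun l => M.val (b + 1 - l)) a ∧ a ≤ b + 1 := by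
  classical
  have hlt : ∀ l, 1 ≤ l → (b : ℕ) + 1 - l < k := fun l hl => by have := b.2; omega
  -- As long as the values exceed `√R`, the states are in `A`.
  have hmem : ∀ (l : ℕ) (hl : 1 ≤ l), l ≤ b + 1 →
      (∀ l', 1 ≤ l' → l' < l → √R < M.val (b + 1 - l')) → (⟨b + 1 - l, hlt l hl⟩ : Fin k) ∈ A := by
    intro l hl
    induction l, hl using Nat.le_induction with
    | base => intro _ _; simpa using hb
    | succ l hl ih =>
      intro hlb hgt
      refine h.pred_mem (ih (by omega) fun l' h1 h2 => hgt l' h1 (by omega)) ?_ ?_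
      · rw [← M.val_of_lt]; exact hgt l hl (by omega)
      · simp only; omega
  have hex : ∃ l : ℕ, 1 ≤ l ∧ l ≤ b + 1 ∧ M.val (b + 1 - l) ≤ √R := by
    by_contra! hcon
    have h1 := hmem (b + 1) (by omega) le_rfl fun l' h1 h2 => hcon l' h1 (by omega)
    have h2 := hcon (b + 1) (by omega) le_rfl
    rw [M.val_of_lt (hlt _ (by omega))] at h2
    have h3 := h.down_pos h1 h2
    have h4 := M.down_le ⟨b + 1 - (b + 1), hlt _ (by omega)⟩
    simp only at h4
    omega
  set a := Nat.find hex with ha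
  obtain ⟨ha1, hab, hale⟩ := Nat.find_spec hex
  rw [← ha] at ha1 hab hale
  have hgt : ∀ l, 1 ≤ l → l < a → √R < M.val (b + 1 - l) := by
    intro l h1 h2
    have := Nat.find_min hex h2
    by_contra! hcon
    exact this ⟨h1, by omega, hcon⟩
  refine ⟨a, ⟨ha1, hgt, hale, ?_⟩, hab⟩
  intro l h2 hla
  have hl1 : 1 ≤ l := by omega
  set q : Fin k := ⟨b + 1 - l, hlt l hl1⟩ with hq
  have hqv : (q : ℕ) = b + 1 - l := rfl
  have hqA : q ∈ A := hmem l hl1 (by omega) fun l' h1 h2 => hgt l' h1 (by omega)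
  have hqb : q < b := Fin.lt_def.2 (by omega)
  have hqval : M.val (b + 1 - l) = M.value q := M.val_of_lt _
  have hq2 := hhalf q hqb
  have hqup := hup q hqb
  have hloop := h.self_loop hqA
  have hthr0 := M.thr_lt q (a := -1) (b := 0) (by omega) (by omega) (by omega)
  refine ⟨M.up q, fun j => M.thr q j, h.up_pos hqA (by linarith), by omega, ?_⟩
  rw [hqval]
  refine ⟨?_, ?_, M.thr_top q, hloop.2, ?_⟩
  · intro x hx y hy hxy
    simp only [Set.mem_Iic] at hx hy
    exact M.thr_lt q (by omega) (by omega) (by omega)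
  · exact max_lt ((M.thr_mem_Icc q (by omega) (by omega)).1.trans_lt hthr0)
      (hloop.1.trans_lt hthr0)
  · intro J hJ c _ _
    have hlJ : (q : ℕ) + (J + 1) < k := by have := b.2; omega
    have hbound : ∀ X, M.Edge q ⟨q + (J + 1), hlJ⟩ X →
        circleExcess R (fun l => M.val (b + 1 - l)) l (M.value q) (J + 1) c X ≤ 0 := by
      intro X hX
      refine le_of_forall_pos_le_add fun ε hε => ?_
      set δ := ε / (J + 2) with hδ
      have hJ2 : (0 : ℝ) < J + 2 := by positivity
      have hδ0 : 0 < δ := by positivity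
      obtain ⟨φ, hφ⟩ := h.potential δ hδ0 c
      let ψ : ℕ → ℝ := fun n => if hn : n < k then φ ⟨n, hn⟩ else 0
      have hψ : ∀ n (hn : n < k), ψ n = φ ⟨n, hn⟩ := fun n hn => dif_pos hn
      have h1 := hφ _ _ _ hqA hX
      rw [← hψ, show φ q = ψ q from (hψ q q.2).symm] at h1
      have h3 : ∀ t ∈ Finset.range (J + 1), downExcess R c (M.val (b + 1 - (l - 1 - t))) ≤
          (ψ (q + t) - ψ (q + (t + 1))) + δ := by
        intro t ht
        have ht := Finset.mem_range.1 ht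
        have hv : √R < M.val (b + 1 - (l - 1 - t)) := hgt _ (by omega) (by omega)
        have hm := hmem (l - 1 - t) (by omega) (by omega)
          fun l' h1 h2 => hgt l' h1 (by omega)
        rw [M.val_of_lt (hlt _ (by omega))] at hv ⊢
        have := h.downExcess_le hm hv (hdown _ (Fin.le_def.2 (by simp only; omega)))
          (l := ⟨q + t, by omega⟩) (by simp only; omega) hφ
        rw [hψ _ (by omega), hψ _ (by omega)]
        convert this using 5
        omega
      have h4 := Finset.sum_le_sum h3
      rw [Finset.sum_add_distrib, Finset.sum_range_sub' (fun t => ψ (q + t)), Finset.sum_const,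
        Finset.card_range, nsmul_eq_mul] at h4
      have h5 : (J + 2) * δ = ε := by rw [hδ]; field_simp
      unfold circleExcess
      simp only [add_zero] at h4
      push_cast at h4
      linarith
    refine ⟨hbound _ ?_, hbound _ ?_⟩
    · have := M.edge_bot (i := q) (l := ⟨q + (J + 1), hlJ⟩) ((J : ℤ) + 1) (by omega) (by omega)
        (by simp only; omega)
      rwa [add_sub_cancel_right] at this
    · have := M.edge_top (i := q) (l := ⟨q + (J + 1), hlJ⟩) ((J : ℤ) + 1) (by omega) (by omega)
        (by simp only; omega)
      simpa using this

/-- The reachable states contain the highest state of the lower half and its successor. -/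
theorem Controlled.exists_top (h : M.Controlled R A) (hR2 : √R < 1 / 2) :
    ∃ i ∈ A, ∃ l ∈ A, (l : ℕ) = i + 1 ∧ M.value i ≤ 1 / 2 ∧ 1 / 2 < M.value l := by
  have hlow : ∃ i ∈ A, M.value i ≤ 1 / 2 := by
    obtain ⟨i, hi, hmin⟩ := Set.exists_min_image A id A.toFinite h.nonempty
    refine ⟨i, hi, ?_⟩
    by_contra! hcon
    have hd := h.down_pos hi (by linarith)
    have hdi := M.down_le i
    have hmem := h.pred_mem hi (by linarith) (l := ⟨i - 1, by omega⟩) (by simp only; omega)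
    have := Fin.le_def.1 (hmin _ hmem)
    simp only [id] at this
    omega
  obtain ⟨i, ⟨hi, hi2⟩, hmax⟩ := Set.exists_max_image {i | i ∈ A ∧ M.value i ≤ 1 / 2} id
    (Set.toFinite _) (by obtain ⟨i, hi⟩ := hlow; exact ⟨i, hi⟩)
  have hu := h.up_pos hi (by linarith)
  have hui := M.up_lt i
  have hmem := h.succ_mem hi (by linarith) (l := ⟨i + 1, by omega⟩) rfl
  refine ⟨i, hi, _, hmem, rfl, hi2, ?_⟩
  by_contra! hcon
  have := Fin.le_def.1 (hmax _ ⟨hmem, hcon⟩)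
  simp only [id] at this
  omega

/-- The chain of the lower half. -/
theorem Controlled.exists_isChain_lower (h : M.Controlled R A) (hM : M.IsDTM)
    (hR2 : √R < 1 / 2) {b : Fin k} (hb : b ∈ A) (hb2 : M.value b ≤ 1 / 2)
    (habove : ∀ l > b, 1 / 2 < M.value l) :
    ∃ a Q, IsChain R Q a ∧ a ≤ b + 1 ∧ Q 1 = M.value b ∧ (2 ≤ a → Q 2 < 1 / 2) := by
  have hbelow : ∀ q < b, M.value q < 1 / 2 := fun q hq => (hM.strictMono hq).trans_le hb2
  have hup : ∀ q < b, (q : ℕ) + M.up q ≤ b := by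
    intro q hq
    by_contra! hcon
    have := hM.leave_lower q ⟨q + M.up q, M.up_lt q⟩ (hbelow q hq).le
      (habove _ (Fin.lt_def.2 hcon)) le_rfl
    have hq := Fin.lt_def.1 hq
    simp only at this
    omega
  obtain ⟨a, ha, hab⟩ := h.exists_isChain hR2 hb (fun q hq => (hbelow q hq).le) hup
    fun q hq => hM.down_le_one q ((hM.strictMono.monotone hq).trans hb2)
  refine ⟨a, _, ha, hab, ?_, fun h2 => ?_⟩
  · simp [M.val_of_lt b.2]
  · have := b.2
    rw [M.val_of_lt (by omega)]
    exact hbelow _ (Fin.lt_def.2 (by simp only; omega))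

/-- The chain that consists of the lower half and the lowest state above `1/2`. -/
theorem Controlled.exists_isChain_cross (h : M.Controlled R A) (hM : M.IsDTM)
    (hR2 : √R < 1 / 2) {p q : Fin k} (hq : q ∈ A) (hpq : (q : ℕ) = p + 1)
    (hp2 : M.value p < 1 / 2) (hq2 : 1 / 2 < M.value q) :
    ∃ a Q, IsChain R Q a ∧ a ≤ p + 2 ∧ Q 1 = M.value q ∧ (2 ≤ a → Q 2 < 1 / 2) := by
  have hbelow : ∀ l < q, M.value l < 1 / 2 := fun l hl =>
    (hM.strictMono.monotone (Fin.le_def.2 (by have := Fin.lt_def.1 hl; omega))).trans_lt hp2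
  have hup : ∀ l < q, (l : ℕ) + M.up l ≤ q := by
    intro l hl
    by_contra! hcon
    have h1 : q < (⟨l + M.up l, M.up_lt l⟩ : Fin k) := Fin.lt_def.2 hcon
    have := hM.leave_lower l ⟨l + M.up l, M.up_lt l⟩ (hbelow l hl).le
      (hq2.trans (hM.strictMono h1)) le_rfl
    have hl := Fin.lt_def.1 hl
    simp only at this
    omega
  have hdown : ∀ l ≤ q, M.down l ≤ 1 := by
    intro l hl
    rcases eq_or_lt_of_le hl with rfl | hl
    · by_contra! hcon
      have hd := M.down_le l
      have h1 : (⟨l - M.down l, by omega⟩ : Fin k) < l := Fin.lt_def.2 (by simp only; omega)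
      have := hM.leave_upper l ⟨l - M.down l, by omega⟩ hq2.le (hbelow _ h1) (by simp only; omega)
      simp only at this
      omega
    · exact hM.down_le_one l (hbelow l hl).le
  obtain ⟨a, ha, hab⟩ := h.exists_isChain hR2 hq (fun q hq => (hbelow q hq).le) hup hdown
  refine ⟨a, _, ha, by omega, ?_, fun h2 => ?_⟩
  · simp [M.val_of_lt q.2]
  · have := q.2
    rw [M.val_of_lt (by omega)]
    exact hbelow _ (Fin.lt_def.2 (by simp only; omega))

/-- The circle that joins the two states next to `1/2` keeps one of them at distance at most
`1/2 - start` from `1/2`: the two conditions on `start` come from the samples `1, 0` and from the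
samples `v + √R, 0` and their mirror images. -/
theorem Controlled.start_le (h : M.Controlled R A) (hM : M.IsDTM) (hR : 0 < R)
    (hR2 : √R < 1 / 2) {p q : Fin k} (hp : p ∈ A) (hq : q ∈ A) (hpq : (q : ℕ) = p + 1)
    (hp2 : M.value p < 1 / 2) (hq2 : 1 / 2 < M.value q) :
    start R .even ≤ M.value p ∨ start R .even ≤ 1 - M.value q := by
  have hs := Real.sq_sqrt hR.le
  have hr0 := Real.sqrt_pos.2 hR
  have hup : M.up p = 1 := by
    have h1 := h.up_pos hp (by linarith)
    by_contra! hcon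
    have hlt : q < (⟨p + M.up p, M.up_lt p⟩ : Fin k) := Fin.lt_def.2 (by simp only; omega)
    have := hM.leave_lower p ⟨p + M.up p, M.up_lt p⟩ hp2.le (hq2.trans (hM.strictMono hlt)) le_rfl
    simp only at this
    omega
  have hdown : M.down q = 1 := by
    have h1 := h.down_pos hq (by linarith)
    have hd := M.down_le q
    by_contra! hcon
    have hlt : (⟨q - M.down q, by omega⟩ : Fin k) < p := Fin.lt_def.2 (by simp only; omega)
    have := hM.leave_upper q ⟨q - M.down q, by omega⟩ hq2.le ((hM.strictMono hlt).trans hp2)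
      (by simp only; omega)
    simp only at this
    omega
  -- The constant `c` is the mean of the two samples.
  have hcirc : ∀ X Y, M.value p + √R ≤ X → X ≤ 1 → 0 ≤ Y → Y ≤ M.value q - √R →
      excess R ((X + Y) / 2) (M.value p) X + excess R ((X + Y) / 2) (M.value q) Y ≤ 0 := by
    intro X Y hX0 hX1 hY0 hY1
    refine le_of_forall_pos_le_add fun ε hε => ?_
    obtain ⟨φ, hφ⟩ := h.potential (ε / 2) (by linarith) ((X + Y) / 2)
    have e1 : M.Edge p q X := by
      refine ⟨1, by omega, by omega, by omega, ?_, ?_⟩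
      · rw [sub_self]; exact (h.self_loop hp).2.trans hX0
      · have := M.thr_top p
        rw [hup] at this
        exact hX1.trans_eq this.symm
    have e2 : M.Edge q p Y := by
      refine ⟨-1, by omega, by omega, by omega, ?_, hY1.trans (h.self_loop hq).1⟩
      have := M.thr_bot q
      rw [hdown] at this
      exact this.trans_le hY0
    have h1 := hφ _ _ _ hp e1
    have h2 := hφ _ _ _ hq e2
    linarith
  set v := M.value p
  set w := 1 - M.value q with hw
  have hvw : M.value q = 1 - w := by rw [hw]; ring
  rw [hvw] at hcirc hq2
  by_contra! hcon
  obtain ⟨h1, h2⟩ := hcon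
  rcases le_total (1 - √(R + 1 / 4)) (2 + √R - 2 * √(R + √R + 1 / 2)) with hle | hle
  · rw [start, max_eq_right hle] at h1 h2
    have hq0 : 0 ≤ √(R + √R + 1 / 2) := Real.sqrt_nonneg _
    have hqs := Real.sq_sqrt (show 0 ≤ R + √R + 1 / 2 by positivity)
    have c1 := hcirc (v + √R) 0 le_rfl (by linarith) le_rfl (by linarith)
    have c2 := hcirc 1 (1 - w - √R) (by linarith) le_rfl (by linarith) le_rfl
    unfold excess at c1 c2
    have k1 : (2 * √(R + √R + 1 / 2)) ^ 2 < (2 + √R - v) ^ 2 :=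
      pow_lt_pow_left₀ (by linarith) (by linarith) two_ne_zero
    have k2 : (2 * √(R + √R + 1 / 2)) ^ 2 < (2 + √R - w) ^ 2 :=
      pow_lt_pow_left₀ (by linarith) (by linarith) two_ne_zero
    rw [mul_pow, hqs] at k1 k2
    linarith
  · rw [start, max_eq_left hle] at h1 h2
    have hq0 : 0 ≤ √(R + 1 / 4) := Real.sqrt_nonneg _
    have hqs := Real.sq_sqrt (show 0 ≤ R + 1 / 4 by positivity)
    have c1 := hcirc 1 0 (by linarith) le_rfl le_rfl (by linarith)
    unfold excess at c1
    have k1 : √(R + 1 / 4) ^ 2 < (1 - v) ^ 2 :=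
      pow_lt_pow_left₀ (by linarith) hq0 two_ne_zero
    have k2 : √(R + 1 / 4) ^ 2 < (1 - w) ^ 2 :=
      pow_lt_pow_left₀ (by linarith) hq0 two_ne_zero
    rw [hqs] at k1 k2
    linarith

/-- Comparison of the runs of the algorithm with an arbitrary machine, through its chains on both
sides of `1/2`. -/
theorem Controlled.run_bounds (h : M.Controlled R A) (hM : M.IsDTM) (hR : 0 < R)
    (hR2 : √R < 1 / 2) :
    1 / 6 < √R ∧ (∀ κ i P, IsRun R κ i P → i ≤ k) ∧
      ((∀ i P, IsRun R .odd i P → numStates i .odd ≤ k) ∨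
        start R .even < 1 / 2 ∧ ∀ i P i' P', IsRun R .odd i P → IsRun R .even i' P' →
          numStates i .odd ≤ k ∨ numStates i' .even ≤ k) := by
  obtain ⟨p, hp, q, hq, hpq, hp2, hq2⟩ := h.exists_top hR2
  have hpk := p.2
  have hqk := q.2
  have habove : ∀ l > p, 1 / 2 < M.value l := fun l hl =>
    hq2.trans_le (hM.strictMono.monotone (Fin.le_def.2 (by have := Fin.lt_def.1 hl; omega)))
  have hM' := hM.mirror
  have h' := h.mirror
  obtain ⟨a, Q, hQ, haQ, hQ1, hQ2⟩ := h.exists_isChain_lower hM hR2 hp hp2 habove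
  have hstart0 : ∀ κ i P, IsRun R κ i P → start R κ ≤ 1 / 2 := by
    intro κ i P hrun
    rw [← hrun.start_eq]; exact hrun.first_le_half
  rcases eq_or_lt_of_le hp2 with hp2' | hp2'
  · have hprev := Fin.val_rev p
    obtain ⟨a', Q', hQ', haQ', hQ1', -⟩ := h'.exists_isChain_lower hM' hR2 (b := p.rev)
      (by simpa using hp) (by simp only [FSM.mirror, Fin.rev_rev]; linarith) (by
        intro l hl
        have : l.rev < p := Fin.rev_lt_iff.1 hl
        have := hM.strictMono this
        simp only [FSM.mirror]; linarith)
    have hQ1'' : Q' 1 = 1 / 2 := by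
      rw [hQ1']; simp only [FSM.mirror, Fin.rev_rev]; linarith
    refine ⟨hQ.one_sixth_lt hR hR2 (by linarith) hQ2, fun κ i P hrun => ?_, Or.inl
      fun i P hrun => ?_⟩
    · have := hrun.length_le hR hQ (by linarith [hstart0 κ i P hrun])
      omega
    · have := hrun.length_le hR hQ (by linarith [hstart0 _ i P hrun])
      have := hrun.length_le hR hQ' (by linarith [hstart0 _ i P hrun])
      simp only [numStates]
      omega
  · have hprev := Fin.val_rev p
    have hqrev := Fin.val_rev q
    have hq' : M.mirror.value q.rev < 1 / 2 := by
      simp only [FSM.mirror, Fin.rev_rev]; linarith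
    have hp' : 1 / 2 < M.mirror.value p.rev := by
      simp only [FSM.mirror, Fin.rev_rev]; linarith
    obtain ⟨a₁, Q₁, hQ₁, haQ₁, hQ₁1, hQ₁2⟩ := h.exists_isChain_cross hM hR2 hq hpq hp2' hq2
    obtain ⟨a₂, Q₂, hQ₂, haQ₂, hQ₂1, -⟩ := h'.exists_isChain_cross hM' hR2
      (p := q.rev) (q := p.rev) (by simpa using hp) (by omega) hq' hp'
    obtain ⟨a₃, Q₃, hQ₃, haQ₃, hQ₃1, -⟩ := h'.exists_isChain_lower hM' hR2 (b := q.rev)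
      (by simpa using hq) hq'.le (fun l hl => hp'.trans_le (hM'.strictMono.monotone
        (Fin.le_def.2 (by have := Fin.lt_def.1 hl; omega))))
    have hst := h.start_le hM hR hR2 hp hq hpq hp2' hq2
    have hQ₃1' : Q₃ 1 = 1 - M.value q := by rw [hQ₃1]; simp only [FSM.mirror, Fin.rev_rev]
    refine ⟨hQ₁.one_sixth_lt hR hR2 (by linarith) hQ₁2, fun κ i P hrun => ?_, Or.inr ⟨?_,
      fun i P i' P' hrun hrun' => ?_⟩⟩
    · have := hrun.length_le hR hQ₁ (by linarith [hstart0 κ i P hrun])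
      omega
    · rcases hst with hst | hst <;> linarith
    · have := hrun.length_le hR hQ₁ (by linarith [hstart0 _ i P hrun])
      have := hrun.length_le hR hQ₂ (by linarith [hstart0 _ i P hrun])
      simp only [numStates]
      rcases hst with hst | hst
      · have := hrun'.length_le hR hQ (by linarith)
        omega
      · have := hrun'.length_le hR hQ₃ (by linarith)
        omega

end FSM

/-! ### The machine of a complete run -/

theorem start_even_pos {R : ℝ} (hR : 0 < R) (hR2 : √R < 1 / 2) : 0 < start R .even := by
  have hs := Real.sq_sqrt hR.le
  have : √(R + 1 / 4) < 1 := by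
    rw [Real.sqrt_lt' one_pos]
    nlinarith [Real.sqrt_nonneg R]
  exact (sub_pos.2 this).trans_le (le_max_left _ _)

/-- The circle through the two middle states of an even machine has regret at most `R`. -/
theorem downExcess_add_mirror_le {R : ℝ} (hR : 0 < R) (hR2 : √R < 1 / 2)
    (hlt : start R .even < 1 / 2) {c : ℝ} (h0 : 0 ≤ c) (h1 : c ≤ 1) :
    downExcess R c (1 - start R .even) + downExcess R (1 - c) (1 - start R .even) ≤ 0 := by
  have hs := Real.sq_sqrt hR.le
  have hr0 := Real.sqrt_pos.2 hR
  set p := start R .even with hp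
  have k1 : (1 - p) ^ 2 ≤ R + 1 / 4 := by
    rw [← Real.sq_sqrt (show 0 ≤ R + 1 / 4 by positivity)]
    have : 1 - √(R + 1 / 4) ≤ p := le_max_left _ _
    exact pow_le_pow_left₀ (by linarith) (by linarith) 2
  have k2 : (2 + √R - p) ^ 2 ≤ 4 * (R + √R + 1 / 2) := by
    have h2 : 2 + √R - 2 * √(R + √R + 1 / 2) ≤ p := le_max_right _ _
    have h3 : (2 + √R - p) ^ 2 ≤ (2 * √(R + √R + 1 / 2)) ^ 2 :=
      pow_le_pow_left₀ (by linarith) (by linarith) 2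
    rwa [mul_pow, Real.sq_sqrt (by positivity), show (2 : ℝ) ^ 2 = 4 by norm_num] at h3
  have key : ∀ d, 0 ≤ d → d ≤ 1 - p → 1 - p ≤ 1 - d →
      downExcess R d (1 - p) + downExcess R (1 - d) (1 - p) ≤ 0 := by
    intro d hd0 hd1 hd2
    rw [downExcess_of_le hR.le (by linarith) hd1, downExcess_of_ge hR.le (by linarith) hd2]
    nlinarith [sq_nonneg (2 * d - (p + √R))]
  rcases le_total c (1 - p) with hc | hc
  · rcases le_total (1 - c) (1 - p) with hc' | hc'
    · rw [downExcess_of_le hR.le (by linarith) hc, downExcess_of_le hR.le (by linarith) hc']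
      nlinarith [sq_nonneg (2 * c - 1)]
    · exact key c h0 hc hc'
  · have := key (1 - c) (by linarith) (by linarith) (by linarith)
    rw [sub_sub_cancel] at this
    linarith

/-- The potential of state `t` of the lower half: the excess loss accumulated on the way down from
state `1` by the worst down samples. -/
noncomputable def chainPotential (R : ℝ) (S : ℕ → ℝ) (c : ℝ) (t : ℕ) : ℝ :=
  ∑ u ∈ Finset.range (t - 1), downExcess R c (S (u + 1))

theorem chainPotential_one (R : ℝ) (S : ℕ → ℝ) (c : ℝ) : chainPotential R S c 1 = 0 := by
  simp [chainPotential]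

theorem chainPotential_succ (R : ℝ) (S : ℕ → ℝ) (c : ℝ) {t : ℕ} (ht : 1 ≤ t) :
    chainPotential R S c (t + 1) = chainPotential R S c t + downExcess R c (S t) := by
  obtain ⟨t, rfl⟩ : ∃ t', t = t' + 1 := ⟨t - 1, by omega⟩
  simp [chainPotential, Finset.sum_range_succ]

theorem chainPotential_sub (R : ℝ) (S : ℕ → ℝ) (c : ℝ) {t J : ℕ} (hJ : J + 1 ≤ t) :
    chainPotential R S c t = chainPotential R S c (t - J) +
      ∑ v ∈ Finset.range J, downExcess R c (S (t - 1 - v)) := by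
  induction J with
  | zero => simp
  | succ J ih =>
    rw [ih (by omega), Finset.sum_range_succ]
    have h1 : t - J = t - (J + 1) + 1 := by omega
    rw [h1, chainPotential_succ R S c (by omega), show t - 1 - J = t - (J + 1) by omega]
    ring

theorem continuous_chainPotential (R : ℝ) (S : ℕ → ℝ) (t : ℕ) :
    Continuous fun c => chainPotential R S c t := by
  have := continuous_downExcess R
  unfold chainPotential
  fun_prop

section Output

variable {R : ℝ} {κ : Kind} {n : ℕ} {P : Placement} {k : ℕ} {M : FSM k}

theorem IsRun.one_le_m (h : IsRun R κ n P) {t : ℕ} (h1 : 1 ≤ t) (ht : t ≤ n) : 1 ≤ P.m t := by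
  rcases eq_or_lt_of_le h1 with rfl | h2
  · exact h.m_one.ge
  · exact (h.step t h2 ht).2.one_le

theorem IsRun.T_m (h : IsRun R κ n P) {t : ℕ} (h1 : 1 ≤ t) (ht : t ≤ n) :
    P.T t (P.m t) = 1 := by
  rcases eq_or_lt_of_le h1 with rfl | h2
  · rw [h.m_one, h.T_one_one]
  · exact (h.feasible h2 ht).top

theorem IsRun.T_zero_le (h : IsRun R κ n P) {t : ℕ} (h1 : 1 ≤ t) (ht : t ≤ n) :
    P.T t 0 ≤ P.S t + √R := by
  rcases eq_or_lt_of_le h1 with rfl | h2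
  · exact h.T_one_zero.le
  · exact (h.feasible h2 ht).zero_le

theorem numStates_bounds (h : IsRun R κ n P) (hk : k = numStates n κ) (hk2 : 2 ≤ k) :
    n < k ∧ 1 ≤ n ∧ (κ = .odd ∧ k + 1 = 2 * n ∨ κ = .even ∧ k = 2 * n) := by
  have := h.one_le
  cases κ <;> simp only [numStates] at hk <;> simp <;> omega

theorem IsMachineOf.up_eq (hM : IsMachineOf R n P M) (hk2 : 2 ≤ k) {q : Fin k} (hq : (q : ℕ) < n) :
    M.up q = P.m (n - q) := by
  rw [hM.up_lower q hq, if_neg (by omega)]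

theorem IsMachineOf.thr_eq (hM : IsMachineOf R n P M) (h : IsRun R κ n P) (hk2 : 2 ≤ k) {q : Fin k}
    (hq : (q : ℕ) < n) {j : ℕ} (hj : j ≤ M.up q) : M.thr q j = P.T (n - q) j := by
  rcases eq_or_lt_of_le hj with rfl | hj
  · rw [M.thr_top, hM.up_eq hk2 hq, h.T_m (by omega) (by omega)]
  · exact hM.thr_up_lower q hq j hj

/-- The edges that start in the lower half either stay there and are controlled by the potential,
or lead from the highest state of the lower half to the next state. -/
theorem IsMachineOf.lower_edge (hR : 0 < R) (hM : IsMachineOf R n P M) (h : IsRun R κ n P)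
    (hk2 : 2 ≤ k) {q : Fin k} (hq : (q : ℕ) < n) {j : ℤ} (h1 : -(M.down q : ℤ) ≤ j)
    (h2 : j ≤ M.up q) {X : ℝ} (h3 : M.thr q (j - 1) ≤ X) (h4 : X ≤ M.thr q j) {l : ℕ}
    (hl : (l : ℤ) = (q : ℕ) + j) {c : ℝ} (hc0 : 0 ≤ c) (hc1 : c ≤ 1) :
    (l < n ∧ excess R c (P.S (n - q)) X ≤
      chainPotential R P.S c (n - l) - chainPotential R P.S c (n - q)) ∨
    ((q : ℕ) + 1 = n ∧ l = n ∧ P.S 1 + √R ≤ X ∧ X ≤ 1) := by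
  have hup := hM.up_eq hk2 hq
  have hup1 : 1 ≤ M.up q := by rw [hup]; exact h.one_le_m (by omega) (by omega)
  have hdown := hM.down_lower q hq
  rcases lt_trichotomy j 0 with hj | rfl | hj
  · left
    have hq0 : (q : ℕ) ≠ 0 := by
      intro h0
      rw [hdown, if_pos h0] at h1
      omega
    rw [if_neg hq0] at hdown
    have hj1 : j = -1 := by omega
    subst hj1
    have hbot := M.thr_bot q
    rw [hdown] at hbot
    have hS := h.sqrt_lt (l := n - q) (by omega) (by omega)
    rw [hM.thr_down_lower q hq, max_eq_right (by linarith)] at h4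
    refine ⟨by omega, ?_⟩
    rw [show n - l = n - q + 1 by omega, chainPotential_succ R P.S c (by omega),
      add_sub_cancel_left]
    exact excess_le_downExcess (hbot.symm.trans_le h3) h4
  · left
    have hlq : l = q := by omega
    refine ⟨by omega, ?_⟩
    rw [hlq, sub_self]
    rw [zero_sub, hM.thr_down_lower q hq] at h3
    have h5 := hM.thr_eq h hk2 hq (j := 0) (by omega)
    rw [Nat.cast_zero] at h5
    rw [h5] at h4
    exact excess_nonpos hR.le ((le_max_right _ _).trans h3)
      (h4.trans (h.T_zero_le (by omega) (by omega)))
  · obtain ⟨J, rfl⟩ : ∃ J : ℕ, j = (J + 1 : ℕ) := ⟨(j - 1).toNat, by omega⟩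
    rw [show ((J + 1 : ℕ) : ℤ) - 1 = (J : ℕ) by push_cast; ring,
      hM.thr_eq h hk2 hq (by omega)] at h3
    rw [hM.thr_eq h hk2 hq (by omega)] at h4
    rcases eq_or_lt_of_le (show 1 ≤ n - q by omega) with ht | ht
    · right
      rw [← ht, h.m_one] at hup
      have hJ : J = 0 := by omega
      subst hJ
      rw [← ht, h.T_one_zero] at h3
      rw [← ht, zero_add, h.T_one_one] at h4
      exact ⟨by omega, by omega, h3, h4⟩
    · left
      have hm := (h.step (n - q) ht (by omega)).2.le
      have hf := (h.feasible ht (by omega)).circle J (by omega) c hc0 hc1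
      have := circleExcess_nonpos_of_mem hf.1 hf.2 h3 h4
      refine ⟨by omega, ?_⟩
      rw [chainPotential_sub R P.S c (t := n - q) (J := J + 1) (by omega),
        show n - q - (J + 1) = n - l by omega]
      unfold circleExcess at this
      linarith

/-- The machine of a complete run has maximal regret at most `R`. The potential of its lower half
is `chainPotential`, that of its upper half is the mirror image. -/
theorem IsMachineOf.maxRegret_le (hR : 0 < R) (hR2 : √R < 1 / 2) (hM : IsMachineOf R n P M)
    (h : IsRun R κ n P) (hk : k = numStates n κ) (hk2 : 2 ≤ k) (s₀ : Fin k) :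
    M.maxRegret s₀ ≤ R := by
  classical
  obtain ⟨hnk, hn1, hkn⟩ := numStates_bounds h hk hk2
  -- the potential difference between the two middle states of an even machine
  let K : ℝ → ℝ := fun c => if κ = .even then downExcess R (1 - c) (1 - P.S 1) else 0
  let φ : ℝ → Fin k → ℝ := fun c q => if (q : ℕ) < n then chainPotential R P.S c (n - q)
    else chainPotential R P.S (1 - c) (n - q.rev) + K c
  have hφl : ∀ c (q : Fin k), (q : ℕ) < n → φ c q = chainPotential R P.S c (n - q) :=
    fun c q hq => if_pos hq
  have hφu : ∀ c (q : Fin k), n ≤ (q : ℕ) →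
      φ c q = chainPotential R P.S (1 - c) (n - q.rev) + K c := fun c q hq => if_neg (by omega)
  refine M.maxRegret_le_of_potential φ (fun q => ?_) ?_ s₀
  · have h1 := continuous_chainPotential R P.S
    have h2 := continuous_downExcess R
    have hK : Continuous K := by
      simp only [K]
      split_ifs
      · exact (h2 _).comp (by fun_prop)
      · exact continuous_const
    by_cases hq : (q : ℕ) < n
    · simp only [hφl _ q hq]
      exact h1 _
    · simp only [hφu _ q (not_lt.1 hq)]
      exact ((h1 _).comp (by fun_prop : Continuous fun c : ℝ => 1 - c)).add hK
  · rintro c hc0 hc1 q l X ⟨j, h1, h2, h3, h4, h5⟩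
    have hrq := Fin.val_rev q
    have hrl := Fin.val_rev l
    have hql := l.2
    by_cases hq : (q : ℕ) < n
    · rw [hM.value_lower q hq, hφl c q hq]
      rcases hM.lower_edge hR h hk2 hq h1 h2 h4 h5 h3 hc0 hc1 with ⟨hl, hle⟩ | ⟨hq1, hln, hX, hX1⟩
      · rwa [hφl c l hl]
      · rw [hφu c l hln.ge, show n - q = 1 by omega, chainPotential_one, sub_zero]
        have hmir : excess R c (P.S 1) X ≤ downExcess R (1 - c) (1 - P.S 1) := by
          rw [← excess_mirror]
          exact excess_le_downExcess (by linarith) (by linarith)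
        rcases hkn with ⟨rfl, hkn⟩ | ⟨rfl, hkn⟩
        · rw [show n - (l.rev : ℕ) = 1 + 1 by omega, chainPotential_succ R P.S _ le_rfl,
            chainPotential_one]
          simp only [K, reduceCtorEq, if_false]
          rw [h.start_eq, start] at hmir ⊢
          norm_num at hmir ⊢
          exact hmir
        · rw [show n - (l.rev : ℕ) = 1 by omega, chainPotential_one]
          simpa only [K, if_true, zero_add] using hmir
    · have hq := not_lt.1 hq
      have hqr : (q.rev : ℕ) < n := by rcases hkn with hkn | hkn <;> omega
      rw [hM.value_upper q hq, hM.value_lower _ hqr, hφu c q hq]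
      have hd := hM.down_upper q hq
      have hu := hM.up_upper q hq
      rw [hM.thr_upper q hq _ (by omega) (by omega), show -(j - 1) - 1 = -j by ring] at h4
      rw [hM.thr_upper q hq _ (by omega) (by omega)] at h5
      have hedge := hM.lower_edge hR h hk2 hqr (j := -j) (by omega) (by omega)
        (X := 1 - X) (by linarith) (by linarith) (l := l.rev) (by omega) (c := 1 - c)
        (by linarith) (by linarith)
      have hmir : excess R (1 - c) (P.S (n - q.rev)) (1 - X) =
          excess R c (1 - P.S (n - q.rev)) X := by
        rw [← excess_mirror, sub_sub_cancel, sub_sub_cancel]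
      rw [hmir] at hedge
      rcases hedge with ⟨hl, hle⟩ | ⟨hq1, hln, hX, hX1⟩
      · by_cases hln : (l : ℕ) < n
        · rcases hkn with ⟨rfl, hkn⟩ | ⟨rfl, hkn⟩
          · rw [show n - (l.rev : ℕ) = 1 by omega, chainPotential_one] at hle
            rw [hφl c l hln, show n - (l : ℕ) = 1 by omega, chainPotential_one]
            simpa [K] using hle
          · omega
        · rw [hφu c l (not_lt.1 hln)]
          linarith
      · rcases hkn with ⟨rfl, hkn⟩ | ⟨rfl, hkn⟩
        · omega
        · rw [hφl c l (by omega), show n - (l : ℕ) = 1 by omega,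
            show n - (q.rev : ℕ) = 1 by omega, chainPotential_one, chainPotential_one]
          simp only [K, if_true]
          have hlt := h.start_lt rfl
          rw [h.start_eq] at hlt hX ⊢
          have := downExcess_add_mirror_le hR hR2 hlt hc0 hc1
          have hX2 : X ≤ 1 - start R .even - √R := by linarith
          have := excess_le_downExcess (R := R) (c := c) (by linarith : 0 ≤ X) hX2
          linarith

theorem IsMachineOf.isDTM (hM : IsMachineOf R n P M) (h : IsRun R κ n P) (hk : k = numStates n κ)
    (hk2 : 2 ≤ k) : M.IsDTM := by
  obtain ⟨hnk, hn1, hkn⟩ := numStates_bounds h hk hk2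
  have hS1 : ∀ t, 2 ≤ t → t ≤ n → P.S t < 1 / 2 := fun t h2 ht =>
    (h.lt_of_lt le_rfl h2 ht).trans_le h.first_le_half
  have hlow : ∀ q : Fin k, (q : ℕ) < n → M.value q ≤ 1 / 2 := fun q hq => by
    rw [hM.value_lower q hq]
    exact h.le_half (by omega) (by omega)
  have hlow' : ∀ q : Fin k, (q : ℕ) < n → 1 / 2 ≤ M.value q → κ = .odd ∧ (q : ℕ) + 1 = n := by
    intro q hq hv
    rw [hM.value_lower q hq] at hv
    have h1 : (q : ℕ) + 1 = n := by
      by_contra! hcon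
      linarith [hS1 (n - q) (by omega) (by omega)]
    refine ⟨?_, h1⟩
    rcases hkn with hkn | hkn
    · exact hkn.1
    · rw [show n - (q : ℕ) = 1 by omega] at hv
      linarith [h.start_lt hkn.1]
  have hupp : ∀ q : Fin k, n ≤ (q : ℕ) → (q.rev : ℕ) < n ∧ 1 / 2 < M.value q := by
    intro q hq
    have hrq := Fin.val_rev q
    have hqk := q.2
    have hqr : (q.rev : ℕ) < n := by rcases hkn with hkn | hkn <;> omega
    refine ⟨hqr, ?_⟩
    rw [hM.value_upper q hq, hM.value_lower _ hqr]
    have : P.S (n - q.rev) < 1 / 2 := by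
      rcases eq_or_lt_of_le (show 1 ≤ n - (q.rev : ℕ) by omega) with h1 | h1
      · rcases hkn with hkn | hkn
        · omega
        · rw [← h1]; exact h.start_lt hkn.1
      · exact hS1 _ h1 (by omega)
    linarith
  have hup : ∀ q : Fin k, (q : ℕ) < n → (q : ℕ) + M.up q < n ∨ (q : ℕ) + 1 = n ∧ M.up q = 1 := by
    intro q hq
    rw [hM.up_eq hk2 hq]
    rcases eq_or_lt_of_le (show 1 ≤ n - (q : ℕ) by omega) with h1 | h1
    · right
      rw [← h1]
      exact ⟨by omega, h.m_one⟩
    · left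
      have := (h.step _ h1 (by omega)).2.le
      omega
  have hdown : ∀ q : Fin k, (q : ℕ) < n → M.down q ≤ 1 := by
    intro q hq
    rw [hM.down_lower q hq]
    split_ifs <;> simp
  refine ⟨?_, ?_, ?_, ?_, ?_⟩
  · intro a b hab
    have hab := Fin.lt_def.1 hab
    by_cases hb : (b : ℕ) < n
    · rw [hM.value_lower a (by omega), hM.value_lower b hb]
      exact h.lt_of_lt (by omega) (by omega) (by omega)
    · have hb2 := hupp b (not_lt.1 hb)
      by_cases ha : (a : ℕ) < n
      · exact (hlow a ha).trans_lt hb2.2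
      · have ha2 := hupp a (not_lt.1 ha)
        rw [hM.value_upper a (not_lt.1 ha), hM.value_upper b (not_lt.1 hb),
          hM.value_lower _ ha2.1, hM.value_lower _ hb2.1]
        have h1 := Fin.val_rev a
        have h2 := Fin.val_rev b
        have := h.lt_of_lt (a := n - a.rev) (b := n - b.rev) (by omega) (by omega) (by omega)
        linarith
  · intro i hi
    by_cases hin : (i : ℕ) < n
    · exact hdown i hin
    · linarith [(hupp i (not_lt.1 hin)).2]
  · intro i hi
    by_cases hin : (i : ℕ) < n
    · have := hlow' i hin hi
      rcases hup i hin with h1 | h1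
      · omega
      · exact h1.2.le
    · rw [hM.up_upper i (not_lt.1 hin)]
      exact hdown _ (hupp i (not_lt.1 hin)).1
  · intro i l hi hl hil
    have hin : (i : ℕ) < n := by
      by_contra! hcon
      linarith [(hupp i hcon).2]
    have hln : n ≤ (l : ℕ) := by
      by_contra! hcon
      linarith [hlow l hcon]
    rcases hup i hin with h1 | h1 <;> omega
  · intro i l hi hl hil
    have hln : (l : ℕ) < n := by
      by_contra! hcon
      linarith [(hupp l hcon).2]
    by_cases hin : (i : ℕ) < n
    · have h1 := hlow' i hin hi
      have h2 := hdown i hin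
      have h3 : (l : ℕ) ≠ i := by
        intro heq
        rw [Fin.ext heq] at hl
        linarith
      omega
    · have h1 := (hupp i (not_lt.1 hin)).1
      rw [hM.down_upper i (not_lt.1 hin)] at hil
      have h2 := Fin.val_rev i
      rcases hkn with hkn | hkn
      · have h3 : (l : ℕ) + 1 ≠ n := by
          intro heq
          rw [hM.value_lower l hln, show n - (l : ℕ) = 1 by omega, h.start_eq, hkn.1, start] at hl
          exact lt_irrefl _ hl
        rcases hup _ h1 with h4 | h4 <;> omega
      · rcases hup _ h1 with h4 | h4 <;> omega

/-- The thresholds of state `t` of the lower half. -/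
noncomputable def lowerThr (R : ℝ) (P : Placement) (t : ℕ) (j : ℤ) : ℝ :=
  if j ≤ -2 then 0 else if j = -1 then max 0 (P.S t - √R) else P.T t j.toNat

theorem lowerThr_natCast (R : ℝ) (P : Placement) (t j : ℕ) : lowerThr R P t j = P.T t j := by
  simp only [lowerThr]
  rw [if_neg (by omega), if_neg (by omega), Int.toNat_natCast]

theorem lowerThr_neg_one (R : ℝ) (P : Placement) (t : ℕ) :
    lowerThr R P t (-1) = max 0 (P.S t - √R) := by
  simp [lowerThr]

theorem lowerThr_bot (h : IsCompleteRun R κ n P) {q : ℕ} :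
    lowerThr R P (n - q) (-(if q = 0 then 0 else 1 : ℕ) - 1) = 0 := by
  split_ifs with hq
  · have := h.2
    simp only [hq, Nat.cast_zero, neg_zero, zero_sub, Nat.sub_zero, lowerThr_neg_one]
    exact max_eq_left (by linarith)
  · simp [lowerThr]

theorem lowerThr_strictMonoOn (hR : 0 < R) (hR2 : √R < 1 / 2) (h : IsRun R κ n P) {q : ℕ}
    (hq : q < n) : StrictMonoOn (lowerThr R P (n - q))
      (Set.Icc (-(if q = 0 then 0 else 1 : ℕ) - 1) (P.m (n - q))) := by
  have hr0 := Real.sqrt_pos.2 hR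
  have h1 := h.first_le_half
  have hpos : 0 < P.S 1 := by
    rw [h.start_eq]
    cases κ with
    | odd => simp only [start]; norm_num
    | even => exact start_even_pos hR hR2
  have hT : StrictMonoOn (P.T (n - q)) (Set.Iic (P.m (n - q))) ∧
      max 0 (P.S (n - q) - √R) < P.T (n - q) 0 := by
    rcases eq_or_lt_of_le (show 1 ≤ n - q by omega) with ht | ht
    · rw [← ht, h.m_one, h.T_one_zero]
      refine ⟨fun x hx y hy hxy => ?_, max_lt (by linarith) (by linarith)⟩
      simp only [Set.mem_Iic] at hx hy
      have hx0 : x = 0 := by omega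
      have hy1 : y = 1 := by omega
      rw [hx0, hy1, h.T_one_zero, h.T_one_one]
      linarith
    · exact ⟨(h.feasible ht (by omega)).strictMono, (h.feasible ht (by omega)).down_lt⟩
  intro a ha b hb hab
  simp only [Set.mem_Icc] at ha hb
  have hle : ∀ y : ℕ, y ≤ P.m (n - q) → P.T (n - q) 0 ≤ P.T (n - q) y := fun y hy =>
    hT.1.monotoneOn (by simp) (by simpa using hy) (Nat.zero_le _)
  have ha2 : a = -2 ∨ a = -1 ∨ 0 ≤ a := by split_ifs at ha <;> omega
  rcases ha2 with rfl | rfl | ha0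
  · have hq0 : q ≠ 0 := by
      rintro rfl
      simp at ha
    have hS := h.sqrt_lt (l := n - q) (by omega) (by omega)
    have hbot : lowerThr R P (n - q) (-2) = 0 := by simp [lowerThr]
    rw [hbot]
    rcases eq_or_lt_of_le (show -1 ≤ b by omega) with rfl | hb0
    · rw [lowerThr_neg_one]
      exact lt_max_of_lt_right (by linarith)
    · obtain ⟨y, rfl⟩ : ∃ y : ℕ, b = y := ⟨b.toNat, by omega⟩
      rw [lowerThr_natCast]
      exact ((le_max_left _ _).trans_lt hT.2).trans_le (hle y (by omega))
  · obtain ⟨y, rfl⟩ : ∃ y : ℕ, b = y := ⟨b.toNat, by omega⟩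
    rw [lowerThr_natCast, lowerThr_neg_one]
    exact hT.2.trans_le (hle y (by omega))
  · obtain ⟨x, rfl⟩ : ∃ x : ℕ, a = x := ⟨a.toNat, by omega⟩
    obtain ⟨y, rfl⟩ : ∃ y : ℕ, b = y := ⟨b.toNat, by omega⟩
    rw [lowerThr_natCast, lowerThr_natCast]
    exact hT.1 (by simp; omega) (by simp; omega) (by omega)

theorem IsCompleteRun.two_le_numStates (hR2 : √R < 1 / 2) (h : IsCompleteRun R κ n P) :
    2 ≤ numStates n κ := by
  have h1 := h.1.one_le
  cases κ with
  | odd =>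
    have : n ≠ 1 := by
      rintro rfl
      have := h.2
      rw [h.1.start_eq, start] at this
      linarith
    simp only [numStates]; omega
  | even => simp only [numStates]; omega

/-- Every complete run describes a machine. -/
theorem IsCompleteRun.exists_machine (hR : 0 < R) (hR2 : √R < 1 / 2)
    (h : IsCompleteRun R κ n P) : ∃ M : FSM (numStates n κ), IsMachineOf R n P M := by
  obtain ⟨k, hk⟩ : ∃ k, k = numStates n κ := ⟨_, rfl⟩
  have hk2 : 2 ≤ k := hk ▸ h.two_le_numStates hR2
  rw [← hk]
  obtain ⟨hnk, hn1, hkn⟩ := numStates_bounds h.1 hk hk2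
  have hrev : ∀ q : Fin k, ¬ (q : ℕ) < n → (q.rev : ℕ) < n := by
    intro q hq
    have hrq := Fin.val_rev q
    have hqk := q.2
    rcases hkn with hkn | hkn <;> omega
  have hm : ∀ q, q < n → q + P.m (n - q) ≤ n := by
    intro q hq
    rcases eq_or_lt_of_le (show 1 ≤ n - q by omega) with ht | ht
    · rw [← ht, h.1.m_one]; omega
    · have := (h.1.step _ ht (by omega)).2.le
      omega
  let M : FSM k :=
    { value := fun q => if (q : ℕ) < n then P.S (n - q) else 1 - P.S (n - q.rev)
      down := fun q => if (q : ℕ) < n then (if (q : ℕ) = 0 then 0 else 1) else P.m (n - q.rev)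
      up := fun q => if (q : ℕ) < n then P.m (n - q) else (if (q.rev : ℕ) = 0 then 0 else 1)
      thr := fun q j => if (q : ℕ) < n then lowerThr R P (n - q) j
        else 1 - lowerThr R P (n - q.rev) (-j - 1)
      down_le := fun q => by
        have hrq := Fin.val_rev q
        by_cases hq : (q : ℕ) < n
        · simp only [hq, if_true]
          split_ifs <;> omega
        · simp only [hq, if_false]
          have := hm _ (hrev q hq)
          omega
      up_lt := fun q => by
        have hrq := Fin.val_rev q
        have hqk := q.2
        by_cases hq : (q : ℕ) < n
        · simp only [hq, if_true]
          have := hm _ hq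
          omega
        · simp only [hq, if_false]
          split_ifs <;> omega
      thr_bot := fun q => by
        by_cases hq : (q : ℕ) < n
        · simp only [hq, if_true]
          exact lowerThr_bot h
        · simp only [hq, if_false]
          rw [show -(-(P.m (n - q.rev) : ℤ) - 1) - 1 = (P.m (n - q.rev) : ℕ) by ring,
            lowerThr_natCast, h.1.T_m (by have := hrev q hq; omega) (by omega), sub_self]
      thr_top := fun q => by
        by_cases hq : (q : ℕ) < n
        · simp only [hq, if_true]
          rw [lowerThr_natCast, h.1.T_m (by omega) (by omega)]
        · simp only [hq, if_false]
          rw [lowerThr_bot h, sub_zero]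
      thr_strictMono := fun q => by
        by_cases hq : (q : ℕ) < n
        · simp only [hq, if_true]
          exact lowerThr_strictMonoOn hR hR2 h.1 hq
        · simp only [hq, if_false]
          intro a ha b hb hab
          simp only [Set.mem_Icc] at ha hb
          have := lowerThr_strictMonoOn hR hR2 h.1 (hrev q hq) (a := -b - 1) (b := -a - 1)
            ⟨by omega, by omega⟩ ⟨by omega, by omega⟩ (by omega)
          simp only
          linarith }
  refine ⟨M, ⟨?_, ?_, ?_, ?_, ?_, ?_, ?_, ?_, ?_⟩⟩
  · intro q hq
    simp only [M, hq, if_true]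
  · intro q hq
    rw [if_neg (by omega)]
    simp only [M, hq, if_true]
  · intro q hq
    simp only [M, hq, if_true]
  · intro q hq
    simp only [M, hq, if_true, lowerThr_neg_one]
  · intro q hq j _
    simp only [M, hq, if_true, lowerThr_natCast]
  · intro q hq
    simp only [M, not_lt.2 hq, hrev q (not_lt.2 hq), if_true, if_false]
  · intro q hq
    simp only [M, not_lt.2 hq, hrev q (not_lt.2 hq), if_true, if_false]
  · intro q hq
    simp only [M, not_lt.2 hq, hrev q (not_lt.2 hq), if_true, if_false]
  · intro q hq j _ _
    simp only [M, not_lt.2 hq, hrev q (not_lt.2 hq), if_true, if_false]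

end Output

/-! ### Machines with a single state -/

section SingleState

variable {R : ℝ} {κ : Kind} {i : ℕ} {P : Placement}

theorem IsRun.sqrt_lt_half (h : IsRun R κ i P) (hi : 2 ≤ i ∨ √R < P.S i) : √R < 1 / 2 := by
  have h1 := h.le_half h.one_le le_rfl
  have h2 := h.first_le_half
  rcases hi with hi | hi
  · linarith [h.sqrt_lt le_rfl hi]
  · linarith

theorem exists_isCompleteRun_one (hR2 : 1 / 2 ≤ √R) : ∃ P, IsCompleteRun R .odd 1 P := by
  obtain ⟨P, hP⟩ := exists_isRun_one R .odd (by simp)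
  exact ⟨P, hP, by rw [hP.start_eq]; exact hR2⟩

theorem exists_isMachineOf_one (hR2 : 1 / 2 ≤ √R) (h : IsRun R .odd 1 P) :
    ∃ M : FSM 1, IsMachineOf R 1 P M := by
  have hS : P.S 1 = 1 / 2 := h.start_eq
  let M : FSM 1 :=
    { value := fun _ => 1 / 2
      down := fun _ => 0
      up := fun _ => 0
      thr := fun _ j => if j = -1 then 0 else 1
      down_le := fun _ => Nat.zero_le _
      up_lt := fun i => by omega
      thr_bot := fun _ => by simp
      thr_top := fun _ => by simp
      thr_strictMono := fun _ a ha b hb hab => by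
        simp only [Set.mem_Icc, Nat.cast_zero] at ha hb
        have h1 : a = -1 := by omega
        have h2 : b = 0 := by omega
        simp [h1, h2] }
  refine ⟨M, ?_, ?_, ?_, ?_, ?_, ?_, ?_, ?_, ?_⟩
  · intro q hq
    simp [M, hS]
  · intro q hq; simp [M]
  · intro q hq
    simp [M]
  · intro q hq
    have h0 : (q : ℕ) = 0 := by omega
    simp only [M, h0, Nat.sub_zero, hS, if_true]
    exact (max_eq_left (by linarith)).symm
  · intro q hq j hj
    exact absurd hj (by simp [M])
  all_goals
    intro q hq
    omega

theorem IsMachineOf.of_one {M : FSM 1} (hM : IsMachineOf R 1 P M) (h : IsRun R .odd 1 P)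
    (hR : 0 < R) (hR2 : 1 / 2 ≤ √R) : M.IsDTM ∧ ∀ s₀, M.maxRegret s₀ ≤ R := by
  have hS : P.S 1 = 1 / 2 := h.start_eq
  have hv : ∀ q, M.value q = 1 / 2 := fun q => by
    have h0 : (q : ℕ) = 0 := by omega
    rw [hM.value_lower q (by omega), h0, Nat.sub_zero, hS]
  refine ⟨⟨Subsingleton.strictMono _, fun i _ => ?_, fun i _ => ?_, fun i l _ hl => ?_,
    fun i l _ hl => ?_⟩, fun s₀ => ?_⟩
  · have := M.down_le i; omega
  · have := M.up_lt i; omega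
  · rw [hv] at hl; exact absurd hl (lt_irrefl _)
  · rw [hv] at hl; exact absurd hl (lt_irrefl _)
  · refine M.maxRegret_le_of_potential (fun _ _ => 0) (fun _ => continuous_const) ?_ s₀
    rintro c _ _ i l X ⟨j, h1, h2, -, h4, h5⟩
    have h6 := (M.thr_mem_Icc i (j := j - 1) (by omega) (by omega)).1
    have h7 := (M.thr_mem_Icc i (j := j) (by omega) h2).2
    rw [hv, sub_self]
    exact excess_nonpos hR.le (by linarith) (by linarith)

end SingleState

end DTM

/-! ### Optimality of the algorithm -/

theorem mainTheorem6 (R : ℝ) (hR : 0 < R) :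
    -- if the regret `R` can be achieved at all, the algorithm always stops, never gets stuck,
    -- and has an output
    ((∃ (k : ℕ) (M : DTM.FSM k) (s₀ : Fin k), M.IsDTM ∧ M.maxRegret s₀ ≤ R) →
      (∃ N : ℕ, ∀ κ i P, DTM.IsRun R κ i P → i ≤ N) ∧
      (∀ κ i P, DTM.IsRun R κ i P → √R < P.S i →
        ∃ P' : DTM.Placement, DTM.IsRun R κ (i + 1) P' ∧
          ∀ l ≤ i, P'.S l = P.S l ∧ P'.m l = P.m l ∧ P'.T l = P.T l) ∧
      ∃ (k : ℕ) (M : DTM.FSM k), DTM.IsOutput R M) ∧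
    -- every output is an optimal DTM machine
    (∀ (k : ℕ) (M : DTM.FSM k), DTM.IsOutput R M →
      M.IsDTM ∧ (∀ s₀ : Fin k, M.maxRegret s₀ ≤ R) ∧
      ∀ (k' : ℕ) (M' : DTM.FSM k') (s₀ : Fin k'), M'.IsDTM → M'.maxRegret s₀ ≤ R → k ≤ k') := by
  open DTM in
  refine ⟨?_, ?_⟩
  · rintro ⟨k, M, s₀, hM, hreg⟩
    rcases lt_or_ge (√R) (1 / 2) with hR2 | hR2
    · obtain ⟨A, hA⟩ := M.exists_controlled hR.le hreg
      obtain ⟨h6, hlen, -⟩ := hA.run_bounds hM hR hR2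
      refine ⟨⟨k, hlen⟩, fun κ i P h hi => h.exists_succ hR h6 hi, ?_⟩
      classical
      have hex : ∃ K κ n P, IsCompleteRun R κ n P ∧ K = numStates n κ := by
        obtain ⟨n, P, hP⟩ := exists_isCompleteRun (κ := .odd) hR h6 (by simp) (hlen .odd)
        exact ⟨_, _, n, P, hP, rfl⟩
      obtain ⟨κ, n, P, hP, hK⟩ := Nat.find_spec hex
      obtain ⟨M', hM'⟩ := hP.exists_machine hR hR2
      refine ⟨_, M', ⟨κ, n, P, hP, rfl, hM'⟩, fun κ' n' P' hP' => ?_⟩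
      rw [← hK]
      exact Nat.find_min' hex ⟨κ', n', P', hP', rfl⟩
    · refine ⟨⟨1, fun κ i P h => ?_⟩, fun κ i P h hi => ?_, ?_⟩
      · by_contra! hcon
        linarith [h.sqrt_lt_half (Or.inl hcon)]
      · linarith [h.sqrt_lt_half (Or.inr hi)]
      · obtain ⟨P, hP⟩ := exists_isCompleteRun_one hR2
        obtain ⟨M', hM'⟩ := exists_isMachineOf_one hR2 hP.1
        refine ⟨1, M', ⟨.odd, 1, P, hP, rfl, hM'⟩, fun κ' n' P' hP' => ?_⟩
        have := hP'.1.one_le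
        cases κ' <;> simp only [numStates] <;> omega
  · rintro k M ⟨⟨κ, n, P, hP, hk, hM⟩, hmin⟩
    rcases lt_or_ge (√R) (1 / 2) with hR2 | hR2
    · have hk2 : 2 ≤ k := hk ▸ hP.two_le_numStates hR2
      refine ⟨hM.isDTM hP.1 hk hk2, hM.maxRegret_le hR hR2 hP.1 hk hk2, fun k' M' s₀ hM' hreg => ?_⟩
      obtain ⟨A, hA⟩ := M'.exists_controlled hR.le hreg
      obtain ⟨h6, hlen, hcase⟩ := hA.run_bounds hM' hR hR2
      obtain ⟨a, Pa, ha⟩ := exists_isCompleteRun (κ := .odd) hR h6 (by simp) (hlen .odd)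
      rcases hcase with hcase | ⟨hstart, hcase⟩
      · exact (hmin _ _ _ ha).trans (hcase _ _ ha.1)
      · obtain ⟨b, Pb, hb⟩ := exists_isCompleteRun (κ := .even) hR h6 (fun _ => hstart)
          (hlen .even)
        rcases hcase _ _ _ _ ha.1 hb.1 with hle | hle
        · exact (hmin _ _ _ ha).trans hle
        · exact (hmin _ _ _ hb).trans hle
    · obtain ⟨P₁, hP₁⟩ := exists_isCompleteRun_one hR2
      have hk1 : k ≤ 1 := hmin _ _ _ hP₁
      have hn := hP.1.one_le
      have hκ : κ = .odd ∧ n = 1 := by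
        cases κ <;> simp only [numStates] at hk <;> simp <;> omega
      obtain ⟨rfl, rfl⟩ := hκ
      have hk' : k = 1 := hk
      subst hk'
      obtain ⟨h1, h2⟩ := hM.of_one hP.1 hR hR2
      exact ⟨h1, h2, fun k' M' s₀ _ _ => s₀.pos⟩
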